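/- **Theorem.** Let $M$ be a non-empty first-order structure in a language $L$, let $\kappa$ be an uncountable cardinal, and suppose that $M$ is $\kappa$-saturated (for instance, $M$ is a monster model of a complete theory $T$, and "small" means "of cardinality less than $\kappa$"). Let $M^{\mathrm{eq}}$ be the structure of imaginaries of $M$: its elements are the classes $\bar m/E$, where $\bar m\in M^n$ and $E$ is an equivalence relation on $M^n$ definable without parameters, and its language $L^{\mathrm{eq}}$ names the sorts $M^n/E$, the $L$-structure on the home sort $M$, and the projections $M^n\to M^n/E$. Let $A\subseteq M^{\mathrm{eq}}$ satisfy $|A|<\kappa$ and $A=\operatorname{acl}^{\mathrm{eq}}(A)$, i.e. $A$ contains every element of $M^{\mathrm{eq}}$ which lies in a finite $A$-definable set. Let $x=(x_i)_{i\in I}$ be a finite or infinite tuple of variables of sorts of $M^{\mathrm{eq}}$ with $|I|<\kappa$, let $p(x)$ be a complete type over $A$ (that is, a strong type over $A$), and let $p(M)$ be the set of its realizations in $M^{\mathrm{eq}}$. Let $E$ be an equivalence relation on $p(M)$ which is type-definable over $A$, i.e. for some set $\Phi(x,y)$ of $L^{\mathrm{eq}}$-formulas over $A$ we have $E(a,b)\iff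 M^{\mathrm{eq}}\models\Phi(a,b)$ for all $a,b\in p(M)$. Suppose that $E$ is bounded, i.e. that the set $p/E$ of $E$-classes on $p(M)$ has fewer than $\kappa$ elements. Then $$|p/E|=1\qquad\text{or}\qquad |p/E|\ge 2^{\aleph_0}.$$ -/

import Mathlib

open FirstOrder Cardinal

universe u v w x y

namespace Imaginaries

/-- A type is small with respect to `κ` if it has fewer than `κ` elements. -/
def IsSmall (κ : Cardinal.{y}) (X : Type x) : Prop :=
  Cardinal.lift.{y} #X < Cardinal.lift.{x} κ

/-- `M` is `κ`-saturated: for every `B ⊆ M` with fewer than `κ` elements, every set of formulas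
in one variable over `B` which is finitely satisfiable in `M` is realized in `M`. -/
def IsSaturated (L : FirstOrder.Language.{u, v}) (M : Type w) [L.Structure M] (κ : Cardinal.{y}) : Prop :=
  ∀ B : Set M, IsSmall κ B → ∀ Γ : Set (L[[B]].Formula (Fin 1)),
    (∀ Γ₀ : Finset (L[[B]].Formula (Fin 1)), (Γ₀ : Set (L[[B]].Formula (Fin 1))) ⊆ Γ →
      ∃ a : Fin 1 → M, ∀ φ ∈ Γ₀, φ.Realize a) →
    ∃ a : Fin 1 → M, ∀ φ ∈ Γ, φ.Realize a

/-! ### The structure of imaginaries -/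

section Eq

variable (L : FirstOrder.Language.{u, v}) (M : Type w) [L.Structure M]

/-- A sort of `M^eq`: a formula `E(x, y)` without parameters, with `x` and `y` tuples of length
`arity`, which defines an equivalence relation on `M ^ arity`. -/
structure ImSort where
  arity : ℕ
  rel : L.Formula (Fin arity ⊕ Fin arity)
  equivalence : Equivalence fun a b : Fin arity → M => rel.Realize (Sum.elim a b)

variable {L M}

/-- The equivalence relation on `M ^ arity` which belongs to a sort. -/
def ImSort.setoid (s : ImSort L M) : Setoid (Fin s.arity → M) :=
  ⟨fun a b => s.rel.Realize (Sum.elim a b), s.equivalence⟩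

variable (L M)

/-- The home sort: elements of `M` up to equality. -/
def homeSort : ImSort L M where
  arity := 1
  rel := (FirstOrder.Language.Term.var (Sum.inl 0)).equal (FirstOrder.Language.Term.var (Sum.inr 0))
  equivalence :=
    { refl := fun a => by simp
      symm := fun {a b} h => by simpa using (by simpa using h : a 0 = b 0).symm
      trans := fun {a b c} h h' => by
        simpa using (by simpa using h : a 0 = b 0).trans (by simpa using h' : b 0 = c 0) }

/-- The universe of `M^eq`: the disjoint union of all the sorts `M ^ n / E`. -/
abbrev ImElt : Type (max u v w) := Σ s : ImSort L M, Quotient s.setoid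

variable {L M}

/-- The class of a tuple, as an element of `M^eq`; this is the projection `M ^ n → M ^ n / E`. -/
def ImSort.proj (s : ImSort L M) (a : Fin s.arity → M) : ImElt L M :=
  ⟨s, Quotient.mk s.setoid a⟩

variable (L) in
/-- The identification of `M` with the home sort of `M^eq`. -/
def home (m : M) : ImElt L M := (homeSort L M).proj fun _ => m

instance [Nonempty M] : Nonempty (ImElt L M) := Nonempty.map (home L) inferInstance

variable (L M)

/-- The symbols of `L^eq`: a unary predicate for every sort, the symbols of `L` on the home sort
(function symbols through their graphs), and the graphs of the projections
`M ^ n → M ^ n / E`. -/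
inductive ImRel : ℕ → Type (max u v)
  | sort (s : ImSort L M) : ImRel 1
  | fn {n : ℕ} (f : L.Functions n) : ImRel (n + 1)
  | rel {n : ℕ} (R : L.Relations n) : ImRel n
  | proj (s : ImSort L M) : ImRel (s.arity + 1)

/-- The language `L^eq`, in its one-sorted presentation with predicates for the sorts. A subset of
a finite product of sorts is definable by a formula of this language if and only if it is definable
by a many-sorted formula. -/
def imLanguage : FirstOrder.Language.{0, max u v} := ⟨fun _ => Empty, ImRel L M⟩

/-- `M^eq` as a structure for `L^eq`. -/
instance imStructure : (imLanguage L M).Structure (ImElt L M) where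
  funMap := fun f => nomatch f
  RelMap := fun {_} r => match r with
    | .sort s => fun e => (e 0).1 = s
    | .fn (n := n) f => fun e => ∃ m : Fin n → M,
        (∀ i, e i.castSucc = home L (m i)) ∧ e (Fin.last n) = home L (FirstOrder.Language.Structure.funMap f m)
    | .rel (n := n) R => fun e => ∃ m : Fin n → M,
        (∀ i, e i = home L (m i)) ∧ FirstOrder.Language.Structure.RelMap R m
    | .proj s => fun e => ∃ m : Fin s.arity → M,
        (∀ i, e i.castSucc = home L (m i)) ∧ e (Fin.last s.arity) = s.proj m

variable {L M}

/-- `acl^eq(A)`: the elements of `M^eq` which lie in a finite `A`-definable subset of `M^eq`. -/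
def acleq (A : Set (ImElt L M)) : Set (ImElt L M) :=
  {e | ∃ D : Set (ImElt L M), A.Definable₁ (imLanguage L M) D ∧ D.Finite ∧ e ∈ D}

variable [Nonempty M]

/-- Complete types over `A ⊆ M^eq` in the variables `(x_i)_{i ∈ ι}`: complete types over the theory
of `M^eq` with constants for the elements of `A`. -/
abbrev TypeOver (A : Set (ImElt L M)) (ι : Type x) :=
  (((imLanguage L M)[[A]]).completeTheory (ImElt L M)).CompleteType ι

/-- The formula saying that `x_i` is of sort `s`. -/
def sortFormula (A : Set (ImElt L M)) {ι : Type x} (s : ImSort L M) (i : ι) :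
    ((imLanguage L M)[[A]]).Formula ι :=
  FirstOrder.Language.Relations.formula (L := (imLanguage L M)[[A]]) (n := 1)
    (Sum.inl (ImRel.sort s)) ![FirstOrder.Language.Term.var i]

/-- Every variable of the type `p` has a sort, as is required of types in `M^eq`. -/
def IsSorted {A : Set (ImElt L M)} {ι : Type x} (p : TypeOver A ι) : Prop :=
  ∀ i : ι, ∃ s : ImSort L M, FirstOrder.Language.Formula.equivSentence (sortFormula A s i) ∈ p

/-- The set `p(M)` of the tuples in `M^eq` which realize `p`. -/
def realizations {A : Set (ImElt L M)} {ι : Type x} (p : TypeOver A ι) : Set (ι → ImElt L M) :=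
  {b | FirstOrder.Language.Theory.typeOf (((imLanguage L M)[[A]]).completeTheory (ImElt L M)) b = p}

/-- The relation `E` on `p(M)` is type-definable over `A`: it is the intersection with
`p(M) × p(M)` of a set which is defined by a set of formulas `φ(x, y)` over `A`. -/
def IsTypeDefinable {A : Set (ImElt L M)} {ι : Type x} {p : TypeOver A ι}
    (E : Setoid (realizations p)) : Prop :=
  ∃ Φ : Set (((imLanguage L M)[[A]]).Formula (ι ⊕ ι)), ∀ a b : realizations p,
    E a b ↔ ∀ φ ∈ Φ, φ.Realize (Sum.elim a.1 b.1)

end Eq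

end Imaginaries

/-! Call an `A`-definable relation containing `E` an entourage. Since `E` is type-definable, it is
the intersection of its entourages on `p(M)`, and by compactness each entourage `U` has a half `V`
with `V ∘ V ⊆ U` on `p(M)` (`exists_half`). Thus the entourages behave like a uniformity, and there
are two cases.

If every entourage contains an inequivalent pair, completeness of `p` moves such a pair to start at
any given realization (`exists_mem_entourage`). Hence every ball contains two smaller balls with no
`E`-related points between them. Iterating gives a binary tree of balls; by saturation every branch
has a common point, and different branches give inequivalent points, so there are at least `2 ^ ℵ₀`
classes (`two_power_aleph0_le`).

Otherwise some entourage `U` agrees with `E` on `p(M)`, so `E` is relatively definable. A formula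
involves finitely many variables, so the tuple may be taken finite. By compactness `U` is an
equivalence relation on some definable set of `p`, and boundedness leaves finitely many classes
there. The code in `M^eq` of the class of a realization is then algebraic over `A`, hence in `A`;
the class is `A`-definable, and completeness of `p` puts all realizations in it (`mem_of_bounded`).

Automorphisms are not used: homogeneity is replaced by completeness of `p` and compactness.
Compactness in `M^eq` is deduced from one-variable saturation of `M`, by passing first to small
tuples and then to imaginaries through their representatives. -/

namespace Imaginaries

open FirstOrder.Language

/-! ### Cardinal arithmetic of small sets. -/

section Small

variable {κ : Cardinal.{y}}

/-- Phrasing smallness through embeddings allows comparison across universes without cardinal lifts.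
-/
theorem isSmall_iff {X : Type*} : IsSmall κ X ↔ ¬ Nonempty (κ.out ↪ X) := by
  rw [← Cardinal.lift_mk_le', mk_out, not_le, IsSmall]

theorem IsSmall.of_injective {X Y : Type*} (hX : IsSmall κ X) (f : Y → X)
    (hf : Function.Injective f) : IsSmall κ Y := by
  rw [isSmall_iff] at hX ⊢
  exact fun ⟨g⟩ => hX ⟨g.trans ⟨f, hf⟩⟩

theorem IsSmall.of_surjective {X Y : Type*} (hX : IsSmall κ X) (f : X → Y)
    (hf : Function.Surjective f) : IsSmall κ Y :=
  hX.of_injective _ (Function.injective_surjInv hf)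

theorem isSmall_of_countable (hκ : ℵ₀ < κ) (X : Type*) [Countable X] : IsSmall κ X := by
  refine lt_of_le_of_lt (Cardinal.lift_le.2 (Cardinal.mk_le_aleph0 (α := X))) ?_
  simpa using hκ

theorem IsSmall.sum (hκ : ℵ₀ < κ) {X : Type*} {Y : Type*} (hX : IsSmall κ X) (hY : IsSmall κ Y) :
    IsSmall κ (X ⊕ Y) := by
  rw [IsSmall, Cardinal.mk_sum, Cardinal.lift_add]
  refine Cardinal.add_lt_of_lt (by simpa using hκ.le) ?_ ?_
  · have := Cardinal.lift_lt.2 hX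
    simpa only [Cardinal.lift_lift] using this
  · have := Cardinal.lift_lt.2 hY
    simpa only [Cardinal.lift_lift] using this

theorem IsSmall.prod (hκ : ℵ₀ < κ) {X : Type*} {Y : Type*} (hX : IsSmall κ X) (hY : IsSmall κ Y) :
    IsSmall κ (X × Y) := by
  rw [IsSmall, Cardinal.mk_prod, Cardinal.lift_mul]
  refine Cardinal.mul_lt_of_lt (by simpa using hκ.le) ?_ ?_
  · have := Cardinal.lift_lt.2 hX
    simpa only [Cardinal.lift_lift] using this
  · have := Cardinal.lift_lt.2 hY
    simpa only [Cardinal.lift_lift] using this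

theorem IsSmall.union (hκ : ℵ₀ < κ) {X : Type*} {s t : Set X} (hs : IsSmall κ s)
    (ht : IsSmall κ t) : IsSmall κ (s ∪ t : Set X) :=
  (hs.sum hκ ht).of_surjective
    (Sum.elim (fun a => ⟨a, Or.inl a.2⟩) (fun a => ⟨a, Or.inr a.2⟩)) <| by
    rintro ⟨a, ha | ha⟩
    exacts [⟨Sum.inl ⟨a, ha⟩, rfl⟩, ⟨Sum.inr ⟨a, ha⟩, rfl⟩]

theorem IsSmall.range {X Y : Type*} (hX : IsSmall κ X) (f : X → Y) : IsSmall κ (Set.range f) :=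
  hX.of_surjective _ Set.rangeFactorization_surjective

end Small

/-! ### Definable sets in possibly infinitely many variables. -/

section Definability

variable {L : FirstOrder.Language.{u, v}} {M : Type w} [L.Structure M] {A B : Set M}
  {α β : Type*}

theorem exists_finset_definable {S : Set (α → M)} (hS : A.Definable L S) :
    ∃ (F : Finset α) (S₀ : Set (F → M)), A.Definable L S₀ ∧
      ∀ x : α → M, x ∈ S ↔ (fun i : F => x i) ∈ S₀ := by
  classical
  obtain ⟨φ, rfl⟩ := hS
  refine ⟨φ.freeVarFinset, _, ⟨φ.restrictFreeVar id, rfl⟩, fun x => ?_⟩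
  exact (BoundedFormula.realize_restrictFreeVar (φ := φ) (f := id)
    (v := fun i : φ.freeVarFinset => x i) x (by simp)).symm

theorem exists_finset_support {S : Set (α → M)} (hS : A.Definable L S) :
    ∃ F : Finset α, ∀ x z : α → M, (∀ i ∈ F, x i = z i) → (x ∈ S ↔ z ∈ S) := by
  obtain ⟨F, S₀, -, h⟩ := exists_finset_definable hS
  refine ⟨F, fun x z hxz => ?_⟩
  rw [h, h, show (fun i : F => x i) = fun i : F => z i from funext fun i => hxz i i.2]

/-- Only finitely many coordinates of `β` occur in a defining formula, so quantifying over an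
infinite tuple is a first-order operation; the remaining coordinates are filled arbitrarily. -/
theorem definable_exists [Nonempty M] {S : Set (α ⊕ β → M)} (hS : A.Definable L S) :
    A.Definable L {z : α → M | ∃ t : β → M, Sum.elim z t ∈ S} := by
  classical
  obtain ⟨F, S₀, hS₀, h⟩ := exists_finset_definable hS
  let f : F → α ⊕ F.toRight := fun i => match i with
    | ⟨Sum.inl a, _⟩ => Sum.inl a
    | ⟨Sum.inr b, hb⟩ => Sum.inr ⟨b, by simpa using hb⟩
  have h' := (hS₀.preimage_comp f).exists_of_finite
  convert h' using 1
  ext z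
  simp only [Set.mem_ofPred_eq, h, Set.mem_preimage]
  constructor
  · rintro ⟨t, ht⟩
    refine ⟨fun b => t b, ?_⟩
    convert ht using 1
    ext ⟨a | b, hi⟩ <;> rfl
  · rintro ⟨t, ht⟩
    refine ⟨fun b => if hb : b ∈ F.toRight then t ⟨b, hb⟩ else Classical.arbitrary M, ?_⟩
    convert ht using 1
    ext ⟨a | b, hi⟩
    · rfl
    · exact dif_pos (by simpa using hi)

theorem definable_eq (A : Set M) (a b : α) : A.Definable L {z : α → M | z a = z b} :=
  ⟨(Term.var a).equal (Term.var b), by ext; simp⟩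

theorem definable_fiber {S : Set (α ⊕ β → M)} (hS : A.Definable L S) (hAB : A ⊆ B) (a : α → M)
    (ha : ∀ i, a i ∈ B) : B.Definable L {z : β → M | Sum.elim a z ∈ S} := by
  rw [Set.definable_iff_exists_formula_sum] at hS ⊢
  obtain ⟨φ, rfl⟩ := hS
  refine ⟨φ.relabel (Sum.elim (fun c : A => Sum.inl (⟨c, hAB c.2⟩ : B))
    (Sum.elim (fun i => Sum.inl ⟨a i, ha i⟩) Sum.inr)), ?_⟩
  ext z
  simp only [Set.mem_ofPred_eq, Formula.realize_relabel]
  refine iff_of_eq (congrArg _ (funext ?_))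
  rintro (c | i | j) <;> rfl

theorem definable_eq_const {b : M} (hb : b ∈ B) (i : α) :
    B.Definable L {z : α → M | z i = b} := by
  have h := definable_fiber (definable_eq (L := L) ∅ (Sum.inr i : Unit ⊕ α) (Sum.inl ()))
    (Set.empty_subset B) (fun _ => b) (fun _ => hb)
  exact h

theorem definable_forall_mem_finset {T : Type*} (s : Finset T) {f : T → Set (α → M)}
    (hf : ∀ i ∈ s, A.Definable L (f i)) : A.Definable L {z | ∀ i ∈ s, z ∈ f i} := by
  have h := Set.definable_iInter_of_finite (ι := s) (f := fun i => f i) fun i => hf i i.2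
  convert h using 1
  ext z
  simp

theorem definable_exists_mem_finset {T : Type*} (s : Finset T) {f : T → Set (α → M)}
    (hf : ∀ i ∈ s, A.Definable L (f i)) : A.Definable L {z | ∃ i ∈ s, z ∈ f i} := by
  have h := Set.definable_iUnion_of_finite (ι := s) (f := fun i => f i) fun i => hf i i.2
  convert h using 1
  ext z
  simp

end Definability

/-! ### From saturation in one variable to saturation in small tuples of variables. -/

section Saturation

variable {L : FirstOrder.Language.{u, v}} {M : Type w} [L.Structure M] {κ : Cardinal.{y}}

/-- In a `κ`-saturated structure, a family of sets which are definable over a small set, in a small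
set of variables, has a common point if every finite subfamily has one. -/
theorem IsSaturated.exists_forall_mem [Nonempty M] (hκ : ℵ₀ < κ) (hM : IsSaturated L M κ) {B : Set M}
    (hB : IsSmall κ B) {J : Type*} (hJ : IsSmall κ J) {𝒟 : Set (Set (J → M))}
    (hd : ∀ D ∈ 𝒟, B.Definable L D)
    (hfip : ∀ 𝒟₀ : Finset (Set (J → M)), ↑𝒟₀ ⊆ 𝒟 → ∃ z, ∀ D ∈ 𝒟₀, z ∈ D) :
    ∃ z, ∀ D ∈ 𝒟, z ∈ D := by
  classical
  -- Partial assignments of values to the variables which remain consistent with every finite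
  -- subfamily. A maximal one is shown to be total.
  let Good : Set (Set (J × M)) := {G |
    ∀ 𝒟₀ : Finset (Set (J → M)), ↑𝒟₀ ⊆ 𝒟 → ∃ z : J → M, (∀ i ∈ G, z i.1 = i.2) ∧ ∀ D ∈ 𝒟₀, z ∈ D}
  have hsupp (𝒟₀ : Finset (Set (J → M))) (h : ↑𝒟₀ ⊆ 𝒟) :
      ∃ F : Finset J, ∀ z t : J → M, (∀ i ∈ F, z i = t i) → (∀ D ∈ 𝒟₀, z ∈ D) → ∀ D ∈ 𝒟₀, t ∈ D := by
    obtain ⟨F, hF⟩ := exists_finset_support (definable_forall_mem_finset 𝒟₀ fun D hD => hd D (h hD))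
    exact ⟨F, fun z t hzt => (hF z t hzt).1⟩
  have hfun {G : Set (J × M)} (hG : ∀ y ⊆ G, y.Finite → y ∈ Good) {j : J} {m m' : M}
      (hm : (j, m) ∈ G) (hm' : (j, m') ∈ G) : m = m' := by
    obtain ⟨z, hz, -⟩ := hG {(j, m), (j, m')} (by simp [Set.insert_subset_iff, hm, hm'])
      (by simp) ∅ (by simp)
    have h₁ := hz (j, m) (by simp)
    have h₂ := hz (j, m') (by simp)
    exact h₁.symm.trans h₂
  /- A tuple which agrees with `G` on a finite set of coordinates can be changed elsewhere. -/
  have hmod {G : Set (J × M)} (hG : ∀ y ⊆ G, y.Finite → y ∈ Good) (F : Finset J) (z : J → M)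
      (hz : ∀ i ∈ G, i.1 ∈ F → z i.1 = i.2) :
      ∃ t : J → M, (∀ i ∈ G, t i.1 = i.2) ∧ (∀ j ∈ F, z j = t j) ∧
        ∀ j, (∀ m, (j, m) ∉ G) → z j = t j := by
    refine ⟨fun j => if h : ∃ m, (j, m) ∈ G then h.choose else z j, ?_, ?_, ?_⟩
    · rintro ⟨j, m⟩ hi
      have h : ∃ m, (j, m) ∈ G := ⟨m, hi⟩
      simp only [dif_pos h]
      exact hfun hG h.choose_spec hi
    · intro j hj
      by_cases h : ∃ m, (j, m) ∈ G
      · simp only [dif_pos h]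
        exact hz (j, h.choose) h.choose_spec hj
      · simp only [dif_neg h]
    · intro j hj
      have h : ¬ ∃ m, (j, m) ∈ G := not_exists.2 hj
      simp only [dif_neg h]
  have hfin {G : Set (J × M)} (hG : ∀ y ⊆ G, y.Finite → y ∈ Good) (F : Finset J) :
      {i ∈ G | i.1 ∈ F}.Finite := by
    refine Set.Finite.of_finite_image (f := Prod.fst) (F.finite_toSet.subset ?_) ?_
    · rintro _ ⟨i, hi, rfl⟩
      exact hi.2
    · rintro ⟨j, m⟩ hi ⟨j', m'⟩ hi' rfl
      exact Prod.ext rfl (hfun hG hi.1 hi'.1)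
  -- A finite subfamily sees only finitely many coordinates, so consistency of an assignment is
  -- tested on its finite parts.
  have hchar : Order.IsOfFiniteCharacter Good := by
    refine fun G => ⟨fun hG y hy _ 𝒟₀ h => ?_, fun hG 𝒟₀ h => ?_⟩
    · obtain ⟨z, hz, hz'⟩ := hG 𝒟₀ h
      exact ⟨z, fun i hi => hz i (hy hi), hz'⟩
    · obtain ⟨F, hF⟩ := hsupp 𝒟₀ h
      obtain ⟨z, hz, hz'⟩ := hG _ (Set.sep_subset _ _) (hfin hG F) 𝒟₀ h
      obtain ⟨t, ht, ht', -⟩ := hmod hG F z fun i hi hi' => hz i ⟨hi, hi'⟩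
      exact ⟨t, ht, hF z t ht' hz'⟩
  obtain ⟨G, -, hGmax⟩ := hchar.exists_maximal (x := ∅) fun 𝒟₀ h => by
    obtain ⟨z, hz⟩ := hfip 𝒟₀ h
    exact ⟨z, by simp, hz⟩
  have hG := hGmax.prop
  have hG' := (hchar G).1 hG
  have htot (j : J) : ∃ m, (j, m) ∈ G := by
    by_contra hj
    rw [not_exists] at hj
    let B' : Set M := B ∪ Prod.snd '' G
    have hB' : IsSmall κ B' := by
      refine hB.union hκ (IsSmall.of_surjective (X := G) ?_ (fun i => ⟨i.1.2, i, i.2, rfl⟩) ?_)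
      · refine hJ.of_injective (fun i => i.1.1) ?_
        rintro ⟨⟨j, m⟩, hi⟩ ⟨⟨j', m'⟩, hi'⟩ (rfl : j = j')
        exact Subtype.ext (Prod.ext rfl (hfun hG' hi hi'))
      · rintro ⟨_, i, hi, rfl⟩
        exact ⟨⟨i, hi⟩, rfl⟩
    -- The values still possible at the unassigned variable `j`. The set is definable although `G`
    -- may be infinite: the constraints of `G` outside the support of `𝒟₀` can be restored
    -- afterwards without changing coordinate `j`.
    let W : Finset (Set (J → M)) → Set (Fin 1 → M) := fun 𝒟₀ =>
      {a | ∃ z : J → M, (∀ i ∈ G, z i.1 = i.2) ∧ (∀ D ∈ 𝒟₀, z ∈ D) ∧ z j = a 0}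
    have hW (𝒟₀ : Finset (Set (J → M))) (h : ↑𝒟₀ ⊆ 𝒟) : B'.Definable L (W 𝒟₀) := by
      obtain ⟨F, hF⟩ := hsupp 𝒟₀ h
      have h₁ := ((definable_forall_mem_finset 𝒟₀ fun D hD => hd D (h hD)).mono
        (Set.subset_union_left (t := Prod.snd '' G))).preimage_comp (Sum.inr : J → Fin 1 ⊕ J)
      have h₂ := definable_forall_mem_finset (A := B') (L := L) (hfin hG' F).toFinset
        (f := fun i => {z : Fin 1 ⊕ J → M | z (Sum.inr i.1) = i.2}) fun i hi =>
          definable_eq_const (show i.2 ∈ B' from Or.inr ⟨i, by simp at hi; exact hi.1, rfl⟩) _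
      convert definable_exists ((h₁.inter h₂).inter
        (definable_eq (L := L) B' (Sum.inr j : Fin 1 ⊕ J) (Sum.inl 0))) using 1
      ext a
      constructor
      · rintro ⟨z, hz, hz', hz''⟩
        exact ⟨z, ⟨hz', fun i hi => hz i (by simp at hi; exact hi.1)⟩, hz''⟩
      · rintro ⟨z, ⟨hz', hz⟩, hz''⟩
        obtain ⟨t, ht, ht', ht''⟩ := hmod hG' F z fun i hi hi' => hz i (by simpa using ⟨hi, hi'⟩)
        exact ⟨t, ht, hF z t ht' hz', (ht'' j hj).symm.trans hz''⟩
    -- Every formula valid on some `W 𝒟₀` is included, in particular a definition of each `W 𝒟₀`; a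
    -- realization is therefore a value by which `G` can be extended.
    obtain ⟨a, ha⟩ := hM B' hB' {φ | ∃ 𝒟₀ : Finset (Set (J → M)), ↑𝒟₀ ⊆ 𝒟 ∧
        ∀ a ∈ W 𝒟₀, φ.Realize a} fun Γ₀ hΓ₀ => by
      choose! f hf hf' using fun φ (hφ : φ ∈ Γ₀) => hΓ₀ hφ
      obtain ⟨z, hz, hz'⟩ := hG (Γ₀.biUnion f) (by simpa using fun φ hφ => hf φ hφ)
      refine ⟨fun _ => z j, fun φ hφ => hf' φ hφ _ ⟨z, hz, fun D hD => hz' D ?_, rfl⟩⟩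
      exact Finset.mem_biUnion.2 ⟨φ, hφ, hD⟩
    refine hj (a 0) (hGmax.mem_of_prop_insert (x := (j, a 0)) fun 𝒟₀ h => ?_)
    obtain ⟨φ, hφ⟩ := hW 𝒟₀ h
    have haW : a ∈ W 𝒟₀ := by
      rw [hφ]
      exact ha φ ⟨𝒟₀, h, fun b hb => by rwa [hφ] at hb⟩
    obtain ⟨z, hz, hz', hz''⟩ := haW
    refine ⟨z, ?_, hz'⟩
    rintro i (rfl | hi)
    exacts [hz'', hz i hi]
  choose t ht using htot
  refine ⟨t, fun D hD => ?_⟩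
  obtain ⟨z, hz, hz'⟩ := hG {D} (by simpa using hD)
  rw [show t = z from funext fun j => (hz _ (ht j)).symm]
  exact hz' D (by simp)

end Saturation

/-! ### Definable sets of `M^eq` pull back to definable sets of `M`. -/

section Tame

variable {L : FirstOrder.Language.{u, v}} {M : Type w} [L.Structure M] {γ δ : Type*}

/-- The indices of the coordinates in `M` of a tuple of imaginaries of sorts `σ`. -/
abbrev RealIndex (σ : γ → ImSort L M) : Type _ := Σ g, Fin (σ g).arity

/-- The tuple of imaginaries of sorts `σ` which is represented by a tuple in `M`. -/
def projTuple (σ : γ → ImSort L M) (m : RealIndex σ → M) (g : γ) : ImElt L M :=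
  (σ g).proj fun i => m ⟨g, i⟩

@[simp]
theorem projTuple_fst (σ : γ → ImSort L M) (m : RealIndex σ → M) (g : γ) :
    (projTuple σ m g).1 = σ g := rfl

theorem exists_proj_eq (e : ImElt L M) : ∃ m, e.1.proj m = e := by
  obtain ⟨s, q⟩ := e
  obtain ⟨m, rfl⟩ := Quotient.exists_rep q
  exact ⟨m, rfl⟩

theorem exists_projTuple_eq (σ : γ → ImSort L M) (e : γ → ImElt L M) (he : ∀ g, (e g).1 = σ g) :
    ∃ m, projTuple σ m = e := by
  obtain rfl : (fun g => (e g).1) = σ := funext he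
  choose m hm using fun g => exists_proj_eq (e g)
  exact ⟨fun i => m i.1 i.2, funext hm⟩

theorem proj_eq_proj_iff (s : ImSort L M) (a b : Fin s.arity → M) :
    s.proj a = s.proj b ↔ s.rel.Realize (Sum.elim a b) := by
  refine ⟨fun h => ?_, fun h => ?_⟩
  · exact Quotient.exact (s := s.setoid) (eq_of_heq (Sigma.mk.inj h).2)
  · exact congrArg (Sigma.mk s) (Quotient.sound (s := s.setoid) h)

theorem home_injective : Function.Injective (home L : M → ImElt L M) := by
  intro a b h
  have := (proj_eq_proj_iff (homeSort L M) _ _).1 h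
  simpa [homeSort] using this

theorem proj_homeSort (m : Fin 1 → M) : (homeSort L M).proj m = home L (m 0) :=
  congrArg _ (funext fun i : Fin 1 => by rw [Subsingleton.elim i 0])

theorem exists_projTuple_apply_eq (σ : γ → ImSort L M) {g : γ} {s : ImSort L M} (h : σ g = s) :
    ∃ f : Fin s.arity → RealIndex σ, ∀ m, projTuple σ m g = s.proj (m ∘ f) := by
  subst h
  exact ⟨fun i => ⟨g, i⟩, fun m => rfl⟩

theorem exists_projTuple_apply_eq_home (σ : γ → ImSort L M) {g : γ} (h : σ g = homeSort L M) :
    ∃ j : RealIndex σ, ∀ m, projTuple σ m g = home L (m j) := by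
  obtain ⟨f, hf⟩ := exists_projTuple_apply_eq σ h
  exact ⟨f (0 : Fin 1), fun m => (hf m).trans (proj_homeSort _)⟩

/-- A set of tuples of imaginaries is tame if it does not distinguish between imaginaries outside a
finite set of sorts, and if its pullbacks to `M` are definable without parameters. -/
def Tame (Q : Set (γ → ImElt L M)) : Prop :=
  (∃ S : Finset (ImSort L M), ∀ π : Equiv.Perm (ImElt L M), (∀ e, e.1 ∈ S → π e = e) →
    ∀ e : γ → ImElt L M, π ∘ e ∈ Q ↔ e ∈ Q) ∧
  ∀ σ : γ → ImSort L M, (∅ : Set M).Definable L (projTuple σ ⁻¹' Q)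

theorem tame_empty : Tame (∅ : Set (γ → ImElt L M)) :=
  ⟨⟨∅, by simp⟩, by simp⟩

theorem Tame.himp {Q R : Set (γ → ImElt L M)} (hQ : Tame Q) (hR : Tame R) :
    Tame {e | e ∈ Q → e ∈ R} := by
  classical
  obtain ⟨⟨S, hS⟩, hQ⟩ := hQ
  obtain ⟨⟨T, hT⟩, hR⟩ := hR
  refine ⟨⟨S ∪ T, fun π hπ e => ?_⟩, fun σ => ?_⟩
  · simp only [Set.mem_ofPred_eq]
    rw [hS π fun e he => hπ e (Finset.mem_union_left _ he),
      hT π fun e he => hπ e (Finset.mem_union_right _ he)]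
  · convert (hQ σ).himp (hR σ) using 1
    ext m
    simp [himp_eq, imp_iff_or_not]

theorem Tame.compl {Q : Set (γ → ImElt L M)} (hQ : Tame Q) : Tame Qᶜ :=
  hQ.himp tame_empty

theorem Tame.preimage_comp {Q : Set (γ → ImElt L M)} (hQ : Tame Q) (f : γ → δ) :
    Tame {e : δ → ImElt L M | e ∘ f ∈ Q} := by
  obtain ⟨⟨S, hS⟩, hQ⟩ := hQ
  refine ⟨⟨S, fun π hπ e => hS π hπ (e ∘ f)⟩, fun σ => ?_⟩
  exact (hQ (σ ∘ f)).preimage_comp fun i => (⟨f i.1, i.2⟩ : RealIndex σ)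

/-- The coordinates in `M` of a pair of tuples of imaginaries. -/
def sumIndex (σ : γ → ImSort L M) (τ : δ → ImSort L M) :
    RealIndex (Sum.elim σ τ) → RealIndex σ ⊕ RealIndex τ
  | ⟨Sum.inl g, j⟩ => Sum.inl ⟨g, j⟩
  | ⟨Sum.inr d, j⟩ => Sum.inr ⟨d, j⟩

theorem projTuple_comp_sumIndex (σ : γ → ImSort L M) (τ : δ → ImSort L M) (m : RealIndex σ → M)
    (t : RealIndex τ → M) : projTuple _ (Sum.elim m t ∘ sumIndex σ τ) =
      Sum.elim (projTuple σ m) (projTuple τ t) := by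
  ext1 (g | _) <;> rfl

/-- The quantifier ranges over infinitely many sorts, so definability of pullbacks alone would not
survive it. By permutation invariance, all elements outside the finitely many sorts seen by `Q` or
by the free variables can be swapped for one another. One sort outside thus stands for all of them,
and the quantifier becomes a finite disjunction of quantifiers over sorts. -/
theorem Tame.exists [Finite γ] {Q : Set (γ ⊕ Unit → ImElt L M)} (hQ : Tame Q) :
    Tame {e : γ → ImElt L M | ∃ a, Sum.elim e (fun _ => a) ∈ Q} := by
  classical
  obtain ⟨⟨S, hS⟩, hQ⟩ := hQ
  have hinv (π : Equiv.Perm (ImElt L M)) (hπ : ∀ e, e.1 ∈ S → π e = e) (e : γ → ImElt L M)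
      (a : ImElt L M) : Sum.elim (π ∘ e) (fun _ => π a) ∈ Q ↔ Sum.elim e (fun _ => a) ∈ Q := by
    rw [← hS π hπ (Sum.elim e _), Sum.comp_elim]
    rfl
  refine ⟨⟨S, fun π hπ e => ?_⟩, fun σ => ?_⟩
  · constructor
    · rintro ⟨a, ha⟩
      refine ⟨π.symm a, ?_⟩
      rw [← hinv π hπ]
      simpa using ha
    · rintro ⟨a, ha⟩
      exact ⟨π a, (hinv π hπ e a).2 ha⟩
  have hsort (s : ImSort L M) : (∅ : Set M).Definable L {m : RealIndex σ → M |
      ∃ a : ImElt L M, a.1 = s ∧ Sum.elim (projTuple σ m) (fun _ => a) ∈ Q} := by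
    have h := (hQ (Sum.elim σ fun _ => s)).preimage_comp (sumIndex σ fun _ : Unit => s)
    convert h.exists_of_finite using 1
    ext m
    simp only [Set.mem_ofPred_eq, Set.mem_preimage, projTuple_comp_sumIndex]
    constructor
    · rintro ⟨a, rfl, ha⟩
      obtain ⟨t, ht⟩ := exists_projTuple_eq (fun _ : Unit => a.1) (fun _ => a) fun _ => rfl
      exact ⟨t, by rwa [ht]⟩
    · rintro ⟨t, ht⟩
      exact ⟨projTuple _ t (), rfl, ht⟩
  let T : Finset (ImSort L M) := S ∪ (Set.finite_range σ).toFinset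
  have hT (a b : ImElt L M) (ha : a.1 ∉ T) (hb : b.1 ∉ T)
      (m : RealIndex σ → M) (h : Sum.elim (projTuple σ m) (fun _ => a) ∈ Q) :
      Sum.elim (projTuple σ m) (fun _ => b) ∈ Q := by
    have hfix (e : ImElt L M) (he : e.1 ∈ T) : Equiv.swap a b e = e :=
      Equiv.swap_apply_of_ne_of_ne (by rintro rfl; exact ha he) (by rintro rfl; exact hb he)
    rw [← hinv (Equiv.swap a b) fun e he => hfix e (Finset.mem_union_left _ he)] at h
    rw [Equiv.swap_apply_left] at h
    convert h using 2
    ext1 g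
    exact (hfix _ (Finset.mem_union_right _ (by simp))).symm
  by_cases hex : ∃ a : ImElt L M, a.1 ∉ T
  · obtain ⟨b, hb⟩ := hex
    convert definable_exists_mem_finset (insert b.1 T) fun s _ => hsort s using 1
    ext m
    simp only [Set.mem_preimage, Set.mem_ofPred_eq]
    constructor
    · rintro ⟨a, ha⟩
      by_cases haT : a.1 ∈ T
      · exact ⟨a.1, Finset.mem_insert_of_mem haT, a, rfl, ha⟩
      · exact ⟨b.1, Finset.mem_insert_self _ _, b, rfl, hT a b haT hb m ha⟩
    · rintro ⟨s, -, a, -, ha⟩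
      exact ⟨a, ha⟩
  · push Not at hex
    convert definable_exists_mem_finset T fun s _ => hsort s using 1
    ext m
    simp only [Set.mem_preimage, Set.mem_ofPred_eq]
    constructor
    · rintro ⟨a, ha⟩
      exact ⟨a.1, hex a, a, rfl, ha⟩
    · rintro ⟨s, -, a, -, ha⟩
      exact ⟨a, ha⟩

theorem Tame.forall [Finite γ] {Q : Set (γ ⊕ Unit → ImElt L M)} (hQ : Tame Q) :
    Tame {e : γ → ImElt L M | ∀ a, Sum.elim e (fun _ => a) ∈ Q} := by
  convert hQ.compl.exists.compl using 1
  ext e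
  simp only [Set.mem_ofPred_eq, Set.mem_compl_iff, not_exists, not_not]

theorem tame_eq (a b : γ) : Tame {e : γ → ImElt L M | e a = e b} := by
  refine ⟨⟨∅, fun π _ e => π.injective.eq_iff⟩, fun σ => ?_⟩
  by_cases h : σ a = σ b
  · obtain ⟨f, hf⟩ := exists_projTuple_apply_eq σ h
    obtain ⟨f', hf'⟩ := exists_projTuple_apply_eq σ (rfl : σ b = σ b)
    rw [Set.empty_definable_iff]
    refine ⟨(σ b).rel.relabel (Sum.elim f f'), ?_⟩
    ext m
    simp only [Set.mem_preimage, Set.mem_ofPred_eq, hf, hf', proj_eq_proj_iff,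
      Formula.realize_relabel, Sum.comp_elim]
  · convert Set.definable_empty using 1
    ext m
    simp only [Set.mem_preimage, Set.mem_ofPred_eq, Set.mem_empty_iff_false, iff_false]
    exact fun h' => h (congrArg Sigma.fst h')

theorem perm_eq_home_iff {π : Equiv.Perm (ImElt L M)}
    (hπ : ∀ e, e.1 ∈ ({homeSort L M} : Finset (ImSort L M)) → π e = e) (e : ImElt L M) (m : M) :
    π e = home L m ↔ e = home L m := by
  conv_lhs => rw [← hπ (home L m) (Finset.mem_singleton_self _)]
  exact π.injective.eq_iff

theorem tame_sort (s : ImSort L M) : Tame {e : Fin 1 → ImElt L M | (e 0).1 = s} := by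
  refine ⟨⟨{s}, fun π hπ e => ?_⟩, fun σ => ?_⟩
  · simp only [Finset.mem_singleton] at hπ
    simp only [Set.mem_ofPred_eq, Function.comp_apply]
    constructor
    · intro h
      rwa [π.injective (hπ _ h)] at h
    · intro h
      rwa [hπ _ h]
  · by_cases h : σ 0 = s
    · convert Set.definable_univ using 1
      ext m
      simp [h]
    · convert Set.definable_empty using 1
      ext m
      simp [h]

theorem tame_fn {n : ℕ} (f : L.Functions n) : Tame {e : Fin (n + 1) → ImElt L M |
    ∃ m : Fin n → M, (∀ i, e i.castSucc = home L (m i)) ∧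
      e (Fin.last n) = home L (Structure.funMap f m)} := by
  refine ⟨⟨{homeSort L M}, fun π hπ e => ?_⟩, fun σ => ?_⟩
  · simp only [Set.mem_ofPred_eq, Function.comp_apply, perm_eq_home_iff hπ]
  · by_cases h : ∀ i, σ i = homeSort L M
    · choose j hj using fun i => exists_projTuple_apply_eq_home σ (h i)
      rw [Set.empty_definable_iff]
      refine ⟨((Term.func f fun i => Term.var (j i.castSucc)).equal (Term.var (j (Fin.last n)))), ?_⟩
      ext m
      simp only [Set.mem_preimage, Set.mem_ofPred_eq, hj, home_injective.eq_iff,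
        Formula.realize_equal, Term.realize_func, Term.realize_var]
      constructor
      · rintro ⟨t, ht, ht'⟩
        rw [ht', funext ht]
      · exact fun h => ⟨_, fun i => rfl, h.symm⟩
    · convert Set.definable_empty using 1
      ext m
      simp only [Set.mem_preimage, Set.mem_ofPred_eq, Set.mem_empty_iff_false, iff_false]
      rintro ⟨t, ht, ht'⟩
      refine h fun i => ?_
      refine Fin.lastCases ?_ (fun i => ?_) i
      · exact congrArg Sigma.fst ht'
      · exact congrArg Sigma.fst (ht i)

theorem tame_rel {n : ℕ} (R : L.Relations n) : Tame {e : Fin n → ImElt L M |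
    ∃ m : Fin n → M, (∀ i, e i = home L (m i)) ∧ Structure.RelMap R m} := by
  refine ⟨⟨{homeSort L M}, fun π hπ e => ?_⟩, fun σ => ?_⟩
  · simp only [Set.mem_ofPred_eq, Function.comp_apply, perm_eq_home_iff hπ]
  · by_cases h : ∀ i, σ i = homeSort L M
    · choose j hj using fun i => exists_projTuple_apply_eq_home σ (h i)
      rw [Set.empty_definable_iff]
      refine ⟨R.formula fun i => Term.var (j i), ?_⟩
      ext m
      simp only [Set.mem_preimage, Set.mem_ofPred_eq, hj, home_injective.eq_iff,
        Formula.realize_rel, Term.realize_var]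
      constructor
      · rintro ⟨t, ht, ht'⟩
        rwa [funext ht]
      · exact fun h => ⟨_, fun i => rfl, h⟩
    · convert Set.definable_empty using 1
      ext m
      simp only [Set.mem_preimage, Set.mem_ofPred_eq, Set.mem_empty_iff_false, iff_false]
      rintro ⟨t, ht, -⟩
      exact h fun i => congrArg Sigma.fst (ht i)

theorem tame_proj (s : ImSort L M) : Tame {e : Fin (s.arity + 1) → ImElt L M |
    ∃ m : Fin s.arity → M, (∀ i, e i.castSucc = home L (m i)) ∧ e (Fin.last _) = s.proj m} := by
  classical
  refine ⟨⟨{homeSort L M, s}, fun π hπ e => ?_⟩, fun σ => ?_⟩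
  · have h₁ := perm_eq_home_iff (π := π) fun e he => hπ e (by simp_all)
    have h₂ (e : ImElt L M) (m : Fin s.arity → M) : π e = s.proj m ↔ e = s.proj m := by
      conv_lhs => rw [← hπ (s.proj m) (by simp [ImSort.proj])]
      exact π.injective.eq_iff
    simp only [Set.mem_ofPred_eq, Function.comp_apply, h₁, h₂]
  · by_cases h : (∀ i : Fin s.arity, σ i.castSucc = homeSort L M) ∧ σ (Fin.last _) = s
    · choose j hj using fun i => exists_projTuple_apply_eq_home σ (h.1 i)
      obtain ⟨f, hf⟩ := exists_projTuple_apply_eq σ h.2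
      rw [Set.empty_definable_iff]
      refine ⟨s.rel.relabel (Sum.elim f j), ?_⟩
      ext m
      simp only [Set.mem_preimage, Set.mem_ofPred_eq, hj, hf, home_injective.eq_iff,
        Formula.realize_relabel, Sum.comp_elim, proj_eq_proj_iff]
      constructor
      · rintro ⟨t, ht, ht'⟩
        rwa [show m ∘ j = t from funext ht]
      · exact fun h => ⟨_, fun i => rfl, h⟩
    · convert Set.definable_empty using 1
      ext m
      simp only [Set.mem_preimage, Set.mem_ofPred_eq, Set.mem_empty_iff_false, iff_false]
      rintro ⟨t, ht, ht'⟩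
      exact h ⟨fun i => congrArg Sigma.fst (ht i), congrArg Sigma.fst ht'⟩

theorem tame_relMap {n : ℕ} (r : (imLanguage L M).Relations n) :
    Tame {e : Fin n → ImElt L M | Structure.RelMap r e} := by
  cases r with
  | sort s => exact tame_sort s
  | fn f => exact tame_fn f
  | rel R => exact tame_rel R
  | proj s => exact tame_proj s

theorem exists_realize_term_eq (t : (imLanguage L M).Term γ) :
    ∃ g, ∀ e : γ → ImElt L M, t.realize e = e g := by
  cases t with
  | var g => exact ⟨g, fun e => rfl⟩
  | func f _ => exact f.elim

theorem tame_boundedFormula {α : Type*} [Finite α] {n : ℕ}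
    (φ : (imLanguage L M).BoundedFormula α n) :
    Tame {e : α ⊕ Fin n → ImElt L M | φ.Realize (e ∘ Sum.inl) (e ∘ Sum.inr)} := by
  induction φ with
  | falsum => exact tame_empty
  | equal t₁ t₂ =>
    obtain ⟨g₁, h₁⟩ := exists_realize_term_eq t₁
    obtain ⟨g₂, h₂⟩ := exists_realize_term_eq t₂
    convert tame_eq g₁ g₂ using 1
    ext e
    simp [BoundedFormula.Realize, h₁, h₂]
  | rel R ts =>
    choose g h using fun i => exists_realize_term_eq (ts i)
    convert (tame_relMap R).preimage_comp g using 1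
    ext e
    simp only [Set.mem_ofPred_eq, BoundedFormula.Realize, h, Sum.elim_comp_inl_inr]
    rfl
  | imp φ ψ hφ hψ => exact hφ.himp hψ
  | @all n φ hφ =>
    convert (hφ.preimage_comp (δ := (α ⊕ Fin n) ⊕ Unit) (Sum.elim (fun a => Sum.inl (Sum.inl a))
      (Fin.snoc (α := fun _ => (α ⊕ Fin n) ⊕ Unit) (fun i => Sum.inl (Sum.inr i))
        (Sum.inr ())))).forall using 1
    ext e
    simp only [Set.mem_ofPred_eq, BoundedFormula.realize_all]
    refine forall_congr' fun a => iff_of_eq ?_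
    congr 1
    ext1 i
    refine Fin.lastCases ?_ (fun i => ?_) i <;> simp

theorem tame_of_definable [Finite γ] {Q : Set (γ → ImElt L M)}
    (hQ : (∅ : Set (ImElt L M)).Definable (imLanguage L M) Q) : Tame Q := by
  obtain ⟨φ, rfl⟩ := Set.empty_definable_iff.1 hQ
  convert (tame_boundedFormula φ).preimage_comp
    (Sum.elim id finZeroElim : γ ⊕ Fin 0 → γ) using 1
  ext e
  simp only [Set.mem_ofPred_eq, Formula.Realize]
  refine iff_of_eq ?_
  congr 1
  exact Subsingleton.elim _ _

/-- A set of tuples of imaginaries which is definable in `M^eq` pulls back to a set which is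
definable in `M`. -/
theorem definable_preimage_projTuple {Q : Set (γ → ImElt L M)}
    (hQ : (∅ : Set (ImElt L M)).Definable (imLanguage L M) Q) (σ : γ → ImSort L M) :
    (∅ : Set M).Definable L (projTuple σ ⁻¹' Q) := by
  obtain ⟨F, Q₀, hQ₀, h⟩ := exists_finset_definable hQ
  convert ((tame_of_definable hQ₀).preimage_comp ((↑) : F → γ)).2 σ using 1
  ext m
  exact h _

end Tame

/-! ### Saturation of `M^eq` and codes of definable sets. -/

section Eq

variable {L : FirstOrder.Language.{u, v}} {M : Type w} [L.Structure M] {κ : Cardinal.{y}}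

theorem definable_fst_eq {γ : Type*} (A : Set (ImElt L M)) (s : ImSort L M) (g : γ) :
    A.Definable (imLanguage L M) {e : γ → ImElt L M | (e g).1 = s} := by
  refine Set.Definable.mono (Set.empty_definable_iff.2 ?_) (Set.empty_subset A)
  let r : (imLanguage L M).Relations 1 := ImRel.sort s
  refine ⟨r.formula ![Term.var g], ?_⟩
  ext e
  rw [Set.mem_ofPred_eq, Set.mem_ofPred_eq, Formula.realize_rel]
  rfl

theorem definable_proj_graph {γ : Type*} (s : ImSort L M) (f : Fin s.arity → γ) (g : γ) :
    (∅ : Set (ImElt L M)).Definable (imLanguage L M) {e : γ → ImElt L M |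
      ∃ m : Fin s.arity → M, (∀ i, e (f i) = home L (m i)) ∧ e g = s.proj m} := by
  let r : (imLanguage L M).Relations (s.arity + 1) := ImRel.proj s
  refine Set.empty_definable_iff.2 ⟨r.formula (Fin.snoc (α := fun _ => _) (fun i => Term.var (f i)) (Term.var g)), ?_⟩
  ext e
  rw [Set.mem_ofPred_eq, Set.mem_ofPred_eq, Formula.realize_rel]
  refine exists_congr fun m => ?_
  simp

/-- Each imaginary parameter is replaced by a representing tuple in `M`: the parameters become
variables, the set is pulled back, and the fibre over the representatives is taken. -/
theorem definable_preimage_projTuple_of_params {J : Type*} {B : Set (ImElt L M)}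
    {B' : Set M} (hB : ∀ b ∈ B, ∃ m : Fin b.1.arity → M, b.1.proj m = b ∧ ∀ i, m i ∈ B')
    {D : Set (J → ImElt L M)} (hD : B.Definable (imLanguage L M) D) (σ : J → ImSort L M) :
    B'.Definable L (projTuple σ ⁻¹' D) := by
  obtain ⟨φ, rfl⟩ := Set.definable_iff_exists_formula_sum.1 hD
  choose m hm hm' using hB
  let τ : B → ImSort L M := fun b => b.1.1
  have h₁ := definable_preimage_projTuple (L := L) (M := M)
    (Set.empty_definable_iff.2 ⟨φ, rfl⟩) (Sum.elim τ σ)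
  have h₂ := definable_fiber (h₁.preimage_comp (sumIndex τ σ)) (Set.empty_subset B')
    (fun i => m i.1 i.1.2 i.2) fun i => hm' _ _ _
  convert h₂ using 1
  ext t
  simp only [Set.mem_preimage, Set.mem_ofPred_eq, projTuple_comp_sumIndex]
  refine iff_of_eq ?_
  congr 2
  ext1 b
  exact (hm b b.2).symm

theorem IsSmall.realIndex (hκ : ℵ₀ < κ) {J : Type*} (hJ : IsSmall κ J) (σ : J → ImSort L M) :
    IsSmall κ (RealIndex σ) := by
  refine (hJ.prod hκ (isSmall_of_countable hκ ℕ)).of_injective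
    (fun i : RealIndex σ => (i.1, (i.2 : ℕ))) ?_
  rintro ⟨j, i⟩ ⟨j', i'⟩ h
  obtain ⟨h, h'⟩ := Prod.mk.inj h
  subst h
  exact congrArg (Sigma.mk j) (Fin.ext h')

/-- The structure of imaginaries of a `κ`-saturated structure is `κ`-saturated in its sorts. -/
theorem IsSaturated.exists_forall_mem_eq [Nonempty M] (hκ : ℵ₀ < κ) (hM : IsSaturated L M κ)
    {B : Set (ImElt L M)} (hB : IsSmall κ B) {J : Type*} (hJ : IsSmall κ J)
    {𝒟 : Set (Set (J → ImElt L M))} (hd : ∀ D ∈ 𝒟, B.Definable (imLanguage L M) D)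
    (hsort : ∀ j, ∃ s : ImSort L M, {e | (e j).1 = s} ∈ 𝒟)
    (hfip : ∀ 𝒟₀ : Finset (Set (J → ImElt L M)), ↑𝒟₀ ⊆ 𝒟 → ∃ z, ∀ D ∈ 𝒟₀, z ∈ D) :
    ∃ z, ∀ D ∈ 𝒟, z ∈ D := by
  classical
  -- Fixing sorts is essential: the conditions that `x` avoids each sort are finitely satisfiable
  -- but have no common solution.
  choose σ hσ using hsort
  choose m hm using fun b : ImElt L M => exists_proj_eq b
  have hJ' : IsSmall κ (RealIndex σ) := hJ.realIndex hκ σ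
  have hB' : IsSmall κ (Set.range fun i : RealIndex fun b : B => b.1.1 => m i.1 i.2) :=
    (hB.realIndex hκ _).range _
  have hd' : ∀ D' ∈ (projTuple σ ⁻¹' ·) '' 𝒟, (Set.range fun i : RealIndex fun b : B => b.1.1 =>
      m i.1 i.2).Definable L D' := by
    rintro _ ⟨D, hD, rfl⟩
    refine definable_preimage_projTuple_of_params
      (fun b hb => ⟨m b, hm b, fun i => ?_⟩) (hd D hD) σ
    exact ⟨⟨⟨b, hb⟩, i⟩, rfl⟩
  obtain ⟨t, ht⟩ := hM.exists_forall_mem hκ hB' hJ' hd' (by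
    intro 𝒟₀ h𝒟₀
    obtain ⟨𝒟₁, h𝒟₁, rfl⟩ := Finset.subset_set_image_iff.1 h𝒟₀
    obtain ⟨F, hF⟩ := exists_finset_support (definable_forall_mem_finset 𝒟₁ fun D hD => hd D (h𝒟₁ hD))
    obtain ⟨z, hz⟩ := hfip (𝒟₁ ∪ F.image fun j => {e | (e j).1 = σ j}) (by
      rw [Finset.coe_union, Set.union_subset_iff]
      refine ⟨h𝒟₁, fun D hD => ?_⟩
      obtain ⟨j, -, rfl⟩ := Finset.mem_image.1 hD
      exact hσ j)
    -- Outside the support `F` the point `z` may have wrong sorts; arbitrary elements of the right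
    -- sorts are put there, so that the tuple has a representative in `M`.
    let z' : J → ImElt L M := fun j =>
      if j ∈ F then z j else (σ j).proj fun _ => Classical.arbitrary M
    have hz' : z' ∈ {z | ∀ D ∈ 𝒟₁, z ∈ D} :=
      (hF z z' fun j hj => (if_pos hj).symm).1 fun D hD => hz D (Finset.mem_union_left _ hD)
    obtain ⟨t, ht⟩ := exists_projTuple_eq σ z' fun j => by
      by_cases hj : j ∈ F
      · simp only [z', if_pos hj]
        exact hz _ (Finset.mem_union_right _ (Finset.mem_image_of_mem _ hj))
      · simp only [z', if_neg hj]
        rfl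
    refine ⟨t, fun D hD => ?_⟩
    obtain ⟨D, hD', rfl⟩ := Finset.mem_image.1 hD
    simpa only [Set.mem_preimage, ht] using hz' D hD')
  exact ⟨projTuple σ t, fun D hD => ht _ ⟨D, hD, rfl⟩⟩

/-- Every definable family of sets of tuples in `M^eq` has canonical parameters in `M^eq`. -/
theorem exists_code_of_empty_definable [Nonempty M] {J K : Type*} [Finite J] [Finite K]
    (τ : J → ImSort L M) (σ : K → ImSort L M) {Q : Set (J ⊕ K → ImElt L M)}
    (hQ : (∅ : Set (ImElt L M)).Definable (imLanguage L M) Q) :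
    ∃ (c : (J → ImElt L M) → ImElt L M) (G : Set (J ⊕ Unit → ImElt L M)),
      (∅ : Set (ImElt L M)).Definable (imLanguage L M) G ∧
      (∀ z, (∀ j, (z j).1 = τ j) → ∀ e, Sum.elim z (fun _ => e) ∈ G ↔ e = c z) ∧
      ∀ z z', (∀ j, (z j).1 = τ j) → (∀ j, (z' j).1 = τ j) → (c z = c z' ↔
        ∀ t, (∀ k, (t k).1 = σ k) → (Sum.elim z t ∈ Q ↔ Sum.elim z' t ∈ Q)) := by
  classical
  obtain ⟨n, ⟨ε⟩⟩ := Finite.exists_equiv_fin (RealIndex τ)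
  let R : (Fin n → M) → (RealIndex σ → M) → Prop := fun a t =>
    Sum.elim (projTuple τ (a ∘ ε)) (projTuple σ t) ∈ Q
  have hR : (∅ : Set M).Definable L {a : Fin n ⊕ RealIndex σ → M | R (a ∘ Sum.inl) (a ∘ Sum.inr)} := by
    have h := (definable_preimage_projTuple hQ (Sum.elim τ σ)).preimage_comp
      (Sum.map ε id ∘ sumIndex τ σ)
    convert h using 1
    ext a
    have ha : a ∘ Sum.map ε id ∘ sumIndex τ σ =
        Sum.elim ((a ∘ Sum.inl) ∘ ε) (a ∘ Sum.inr) ∘ sumIndex τ σ := by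
      ext1 i
      simp only [Function.comp_apply]
      rcases sumIndex τ σ i with j | k <;> rfl
    simp only [Set.mem_ofPred_eq, Set.mem_preimage, ha, projTuple_comp_sumIndex, R]
  have hker : (∅ : Set M).Definable L {a : Fin n ⊕ Fin n → M |
      ∀ t, R (a ∘ Sum.inl) t ↔ R (a ∘ Sum.inr) t} := by
    have h₁ := hR.preimage_comp (β := (Fin n ⊕ Fin n) ⊕ RealIndex σ) (Sum.map Sum.inl id)
    have h₂ := hR.preimage_comp (β := (Fin n ⊕ Fin n) ⊕ RealIndex σ) (Sum.map Sum.inr id)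
    convert ((h₁.himp h₂).inter (h₂.himp h₁)).forall_of_finite using 1
    ext a
    refine forall_congr' fun t => ?_
    simp only [Set.mem_inter_iff, himp_eq, Set.sup_eq_union, Set.mem_union, Set.mem_compl_iff,
      Set.mem_preimage, Set.mem_ofPred_eq]
    exact iff_iff_implies_and_implies.trans (and_congr imp_iff_or_not imp_iff_or_not)
  obtain ⟨ρ, hρ⟩ := Set.empty_definable_iff.1 hker
  have hρ' (a b : Fin n → M) : ρ.Realize (Sum.elim a b) ↔ ∀ t, R a t ↔ R b t := by
    have h : Sum.elim a b ∈ {a : Fin n ⊕ Fin n → M | ∀ t, R (a ∘ Sum.inl) t ↔ R (a ∘ Sum.inr) t} ↔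
        Sum.elim a b ∈ Set.ofPred ρ.Realize := by rw [hρ]
    exact h.symm
  -- Identifying parameters with equal fibres is an equivalence relation definable without
  -- parameters, hence a sort; the class of a parameter codes its fibre.
  let s : ImSort L M := ⟨n, ρ, by
    constructor
    · exact fun a => (hρ' _ _).2 fun t => Iff.rfl
    · exact fun h => (hρ' _ _).2 fun t => ((hρ' _ _).1 h t).symm
    · exact fun h h' => (hρ' _ _).2 fun t => ((hρ' _ _).1 h t).trans ((hρ' _ _).1 h' t)⟩
  have hs (a b : Fin n → M) : s.proj a = s.proj b ↔ ∀ t, R a t ↔ R b t :=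
    (proj_eq_proj_iff s a b).trans (hρ' a b)
  let c : (J → ImElt L M) → ImElt L M := fun z =>
    if h : ∃ m, projTuple τ m = z then s.proj (h.choose ∘ ε.symm)
    else s.proj fun _ => Classical.arbitrary M
  have hRm (m : RealIndex τ → M) (t : RealIndex σ → M) :
      R (m ∘ ε.symm) t ↔ Sum.elim (projTuple τ m) (projTuple σ t) ∈ Q := by
    simp [R, Function.comp_assoc]
  have hc (m : RealIndex τ → M) : c (projTuple τ m) = s.proj (m ∘ ε.symm) := by
    have h : ∃ m', projTuple τ m' = projTuple τ m := ⟨m, rfl⟩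
    simp only [c, dif_pos h]
    refine (hs _ _).2 fun t => ?_
    rw [hRm, hRm, h.choose_spec]
  -- The graph of `c` is expressed in `L^eq` by quantifying over a tuple of the home sort which
  -- represents `z` and projects to the code.
  refine ⟨c, {z | ∃ h : RealIndex τ → ImElt L M,
    (∀ j, ∃ m : Fin (τ j).arity → M, (∀ i, h ⟨j, i⟩ = home L (m i)) ∧ z (Sum.inl j) = (τ j).proj m) ∧
    ∃ m : Fin n → M, (∀ i, h (ε.symm i) = home L (m i)) ∧ z (Sum.inr ()) = s.proj m}, ?_, ?_, ?_⟩
  · have h₁ := Set.definable_iInter_of_finite fun j : J => definable_proj_graph (τ j)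
      (γ := (J ⊕ Unit) ⊕ RealIndex τ) (fun i => Sum.inr ⟨j, i⟩) (Sum.inl (Sum.inl j))
    have h₂ := definable_proj_graph s (γ := (J ⊕ Unit) ⊕ RealIndex τ)
      (fun i => Sum.inr (ε.symm i)) (Sum.inl (Sum.inr ()))
    convert (h₁.inter h₂).exists_of_finite using 1
    ext z
    refine exists_congr fun h => and_congr ?_ Iff.rfl
    simp
  · intro z hz e
    constructor
    · rintro ⟨h, h₁, m', hm', he⟩
      choose m hm hm'' using h₁
      obtain rfl : projTuple τ (fun i => m i.1 i.2) = z := funext fun j => (hm'' j).symm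
      rw [hc]
      refine he.trans (congrArg _ (funext fun i => home_injective (L := L) ?_))
      rw [← hm']
      exact hm _ _
    · rintro rfl
      obtain ⟨m, rfl⟩ := exists_projTuple_eq τ z hz
      exact ⟨fun i => home L (m i), fun j => ⟨_, fun i => rfl, rfl⟩, _, fun i => rfl, hc m⟩
  · intro z z' hz hz'
    obtain ⟨m, rfl⟩ := exists_projTuple_eq τ z hz
    obtain ⟨m', rfl⟩ := exists_projTuple_eq τ z' hz'
    rw [hc, hc, hs]
    simp only [hRm]
    constructor
    · intro h t ht
      obtain ⟨t, rfl⟩ := exists_projTuple_eq σ t ht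
      exact h t
    · exact fun h t => h _ fun k => rfl

/-- The finitely many elements of `A` that occur are adjoined to the parameter tuple, and then held
fixed. -/
theorem exists_code [Nonempty M] {J K : Type*} [Finite J] [Finite K] (τ : J → ImSort L M)
    (σ : K → ImSort L M) {A : Set (ImElt L M)} {Q : Set (J ⊕ K → ImElt L M)}
    (hQ : A.Definable (imLanguage L M) Q) :
    ∃ (c : (J → ImElt L M) → ImElt L M) (G : Set (J ⊕ Unit → ImElt L M)),
      A.Definable (imLanguage L M) G ∧
      (∀ z, (∀ j, (z j).1 = τ j) → ∀ e, Sum.elim z (fun _ => e) ∈ G ↔ e = c z) ∧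
      ∀ z z', (∀ j, (z j).1 = τ j) → (∀ j, (z' j).1 = τ j) → (c z = c z' ↔
        ∀ t, (∀ k, (t k).1 = σ k) → (Sum.elim z t ∈ Q ↔ Sum.elim z' t ∈ Q)) := by
  obtain ⟨A₀, hA₀, hQ⟩ := Set.definable_iff_finitely_definable.1 hQ
  obtain ⟨φ, rfl⟩ := Set.definable_iff_exists_formula_sum.1 hQ
  have hφ := (Set.empty_definable_iff.2 ⟨φ, rfl⟩).preimage_comp (M := ImElt L M)
    (Equiv.sumAssoc _ J K).symm
  obtain ⟨c, G, hG, hc, hc'⟩ := exists_code_of_empty_definable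
    (Sum.elim (fun a : (A₀ : Set (ImElt L M)) => a.1.1) τ) σ hφ
  have hsort (z : J → ImElt L M) (hz : ∀ j, (z j).1 = τ j) (j : (A₀ : Set (ImElt L M)) ⊕ J) :
      (Sum.elim (fun a : (A₀ : Set (ImElt L M)) => a.1) z j).1 =
        Sum.elim (fun a : (A₀ : Set (ImElt L M)) => a.1.1) τ j := by
    rcases j with a | j
    exacts [rfl, hz j]
  refine ⟨fun z => c (Sum.elim (fun a => a.1) z), _, definable_fiber
    (hG.preimage_comp (Equiv.sumAssoc _ J Unit)) (Set.empty_subset A) (fun a => a.1)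
    fun a => hA₀ a.2, fun z hz e => ?_, fun z z' hz hz' => ?_⟩
  · rw [← hc _ (hsort z hz) e, Set.mem_ofPred_eq, Set.mem_preimage]
    refine iff_of_eq (congrArg (· ∈ G) ?_)
    ext1 ((_ | _) | _) <;> rfl
  · rw [hc' _ _ (hsort z hz) (hsort z' hz')]
    refine forall₂_congr fun t _ => ?_
    simp only [Set.mem_preimage, Set.mem_ofPred_eq]
    have h (z : J → ImElt L M) : Sum.elim (Sum.elim (fun a : (A₀ : Set (ImElt L M)) => a.1) z) t ∘
        (Equiv.sumAssoc _ J K).symm = Sum.elim (fun a => a.1) (Sum.elim z t) := by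
      ext1 (_ | _ | _) <;> rfl
    rw [h, h]

end Eq

/-! ### The binary tree argument. -/

/-- A splitting scheme of sets whose halves are separated by an equivalence relation yields
continuum many classes. -/
theorem two_power_aleph0_le_mk_quotient {X : Type x} (E : Setoid X) {N : Type*} [Nonempty N]
    (ball : N → Set X) (child : N → Bool → N) (hsub : ∀ n b, ball (child n b) ⊆ ball n)
    (hsep : ∀ n, ∀ a ∈ ball (child n true), ∀ b ∈ ball (child n false), ¬ E a b)
    (hcomp : ∀ f : ℕ → N, (∀ k, ball (f (k + 1)) ⊆ ball (f k)) → ∃ a, ∀ k, a ∈ ball (f k)) :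
    2 ^ ℵ₀ ≤ #(Quotient E) := by
  let node : (ℕ → Bool) → ℕ → N := fun η k =>
    Nat.rec (Classical.arbitrary N) (fun k n => child n (η k)) k
  choose a ha using fun η => hcomp (node η) fun k => hsub (node η k) (η k)
  have hnode (η η' : ℕ → Bool) (k : ℕ) (h : ∀ j < k, η j = η' j) : node η k = node η' k := by
    induction k with
    | zero => rfl
    | succ k ih =>
      change child (node η k) (η k) = child (node η' k) (η' k)
      rw [ih fun j hj => h j (hj.trans k.lt_succ_self), h k k.lt_succ_self]
  have hinj : Function.Injective fun η => (Quotient.mk E (a η)) := by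
    intro η η' h
    have hE : E (a η) (a η') := Quotient.exact h
    by_contra hne
    have hex : ∃ k, η k ≠ η' k := Function.ne_iff.1 hne
    classical
    have hk := Nat.find_spec hex
    -- Up to their first difference the branches share a node; there they enter opposite, separated
    -- children.
    have hlt := hnode η η' (Nat.find hex) fun j hj => not_not.1 (Nat.find_min hex hj)
    have h₁ : a η ∈ ball (child (node η (Nat.find hex)) (η (Nat.find hex))) := ha η (Nat.find hex + 1)
    have h₂ : a η' ∈ ball (child (node η' (Nat.find hex)) (η' (Nat.find hex))) :=
      ha η' (Nat.find hex + 1)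
    rw [← hlt] at h₂
    rcases hb : η (Nat.find hex) with _ | _ <;> rcases hb' : η' (Nat.find hex) with _ | _ <;>
      rw [hb] at h₁ hk <;> rw [hb'] at h₂ hk
    · exact hk rfl
    · exact hsep _ _ h₂ _ h₁ (E.symm hE)
    · exact hsep _ _ h₁ _ h₂ hE
    · exact hk rfl
  have := Cardinal.lift_mk_le_lift_mk_of_injective hinj
  simpa using this

/-! ### Complete types as families of definable sets, and the relatively definable case. -/

section CompleteFamily

variable {L : FirstOrder.Language.{u, v}} {M : Type w} [L.Structure M] {κ : Cardinal.{y}}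

/-- The family of the `A`-definable sets which are given by the formulas of a complete type over
`A` in sorted variables. -/
structure IsCompleteFamily (A : Set (ImElt L M)) {ι : Type x} (𝒮 : Set (Set (ι → ImElt L M))) :
    Prop where
  definable : ∀ S ∈ 𝒮, A.Definable (imLanguage L M) S
  inter_mem : ∀ S ∈ 𝒮, ∀ T ∈ 𝒮, S ∩ T ∈ 𝒮
  mem_or_compl_mem : ∀ S, A.Definable (imLanguage L M) S → S ∈ 𝒮 ∨ Sᶜ ∈ 𝒮
  sort_mem : ∀ i, ∃ s : ImSort L M, {z | (z i).1 = s} ∈ 𝒮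
  nonempty : ∀ S ∈ 𝒮, S.Nonempty

namespace IsCompleteFamily

variable {A : Set (ImElt L M)} {ι : Type x} {𝒮 : Set (Set (ι → ImElt L M))}

theorem mem_of_subset (h : IsCompleteFamily A 𝒮) {S T : Set (ι → ImElt L M)} (hS : S ∈ 𝒮)
    (hT : A.Definable (imLanguage L M) T) (hST : S ⊆ T) : T ∈ 𝒮 := by
  refine (h.mem_or_compl_mem T hT).resolve_right fun hT' => ?_
  obtain ⟨z, hz, hz'⟩ := h.nonempty _ (h.inter_mem S hS _ hT')
  exact hz' (hST hz)

theorem univ_mem (h : IsCompleteFamily A 𝒮) : Set.univ ∈ 𝒮 := by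
  refine (h.mem_or_compl_mem Set.univ Set.definable_univ).resolve_right fun h' => ?_
  obtain ⟨z, hz⟩ := h.nonempty _ h'
  exact hz trivial

/-- This replaces homogeneity: an `A`-definable set containing one realization belongs to the type,
hence contains every realization. -/
theorem mem_iff (h : IsCompleteFamily A 𝒮) {z : ι → ImElt L M} (hz : z ∈ ⋂₀ 𝒮)
    {S : Set (ι → ImElt L M)} (hS : A.Definable (imLanguage L M) S) : S ∈ 𝒮 ↔ z ∈ S :=
  ⟨fun h' => hz S h', fun h' => (h.mem_or_compl_mem S hS).resolve_right fun h'' => hz _ h'' h'⟩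

/-- The restriction of a complete type to some of the variables. -/
theorem restrict (h : IsCompleteFamily A 𝒮) (F : Finset ι) :
    IsCompleteFamily A {S : Set (F → ImElt L M) | A.Definable (imLanguage L M) S ∧
      {z | (fun i : F => z i) ∈ S} ∈ 𝒮} where
  definable S hS := hS.1
  inter_mem S hS T hT := ⟨hS.1.inter hT.1, h.inter_mem _ hS.2 _ hT.2⟩
  mem_or_compl_mem S hS := (h.mem_or_compl_mem _ (hS.preimage_comp ((↑) : F → ι))).imp
    (fun h' => ⟨hS, h'⟩) fun h' => ⟨hS.compl, h'⟩
  sort_mem i := (h.sort_mem i).imp fun s hs => ⟨definable_fst_eq A s i, hs⟩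
  nonempty S hS := (h.nonempty _ hS.2).image _ |>.mono (by rintro _ ⟨z, hz, rfl⟩; exact hz)

variable [Nonempty M]

/-- Compactness read backwards, for `T` copies of the variables. Directedness of `𝒱` and closure of
`𝒮` under intersection reduce a finite inconsistent subfamily to one `V` and one `S`. -/
theorem exists_forall_notMem (h : IsCompleteFamily A 𝒮) (hκ : ℵ₀ < κ) (hM : IsSaturated L M κ)
    (hι : IsSmall κ ι) {B : Set (ImElt L M)} (hB : IsSmall κ B) (hAB : A ⊆ B)
    {T : Type} [Finite T] {𝒱 : Set (Set (T × ι → ImElt L M))}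
    (hd : ∀ V ∈ 𝒱, B.Definable (imLanguage L M) V) (hne : 𝒱.Nonempty)
    (hdir : ∀ V ∈ 𝒱, ∀ W ∈ 𝒱, ∃ U ∈ 𝒱, U ⊆ V ∩ W)
    (H : ∀ z : T → ι → ImElt L M, (∀ t, z t ∈ ⋂₀ 𝒮) → ∃ V ∈ 𝒱, (fun q => z q.1 q.2) ∉ V) :
    ∃ V ∈ 𝒱, ∃ S ∈ 𝒮, ∀ z : T → ι → ImElt L M, (∀ t, z t ∈ S) → (fun q => z q.1 q.2) ∉ V := by
  classical
  by_contra! hcon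
  let slice : T → Set (ι → ImElt L M) → Set (T × ι → ImElt L M) := fun t S =>
    {z | (fun i => z (t, i)) ∈ S}
  obtain ⟨z, hz⟩ := hM.exists_forall_mem_eq hκ hB (J := T × ι)
    (((isSmall_of_countable hκ T)).prod hκ hι) (𝒟 := 𝒱 ∪ {D | ∃ t, ∃ S ∈ 𝒮, D = slice t S})
    (by
      rintro D (hD | ⟨t, S, hS, rfl⟩)
      · exact hd D hD
      · exact ((h.definable S hS).mono hAB).preimage_comp (Prod.mk t))
    (fun q => (h.sort_mem q.2).imp fun s hs => Or.inr ⟨q.1, _, hs, rfl⟩)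
    (by
      have key : ∀ 𝒟₀ : Finset (Set (T × ι → ImElt L M)),
          ↑𝒟₀ ⊆ 𝒱 ∪ {D | ∃ t, ∃ S ∈ 𝒮, D = slice t S} → ∃ V ∈ 𝒱, ∃ S ∈ 𝒮,
          ∀ z : T → ι → ImElt L M, (∀ t, z t ∈ S) → (fun q => z q.1 q.2) ∈ V →
            ∀ D ∈ 𝒟₀, (fun q => z q.1 q.2) ∈ D := by
        intro 𝒟₀
        induction 𝒟₀ using Finset.induction with
        | empty =>
          obtain ⟨V, hV⟩ := hne
          exact fun _ => ⟨V, hV, _, h.univ_mem, by simp⟩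
        | insert D 𝒟₀ _ ih =>
          rw [Finset.coe_insert, Set.insert_subset_iff]
          rintro ⟨hD, h𝒟₀⟩
          obtain ⟨V, hV, S, hS, hVS⟩ := ih h𝒟₀
          simp only [Finset.forall_mem_insert]
          rcases hD with hD | ⟨t, S', hS', rfl⟩
          · obtain ⟨W, hW, hWV⟩ := hdir V hV D hD
            exact ⟨W, hW, S, hS, fun z hz hz' => ⟨(hWV hz').2, hVS z hz (hWV hz').1⟩⟩
          · exact ⟨V, hV, _, h.inter_mem S hS S' hS', fun z hz hz' =>
              ⟨(hz t).2, hVS z (fun t => (hz t).1) hz'⟩⟩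
      intro 𝒟₀ h𝒟₀
      obtain ⟨V, hV, S, hS, hVS⟩ := key 𝒟₀ h𝒟₀
      obtain ⟨z, hz, hz'⟩ := hcon V hV S hS
      exact ⟨_, hVS z hz hz'⟩)
  obtain ⟨V, hV, hzV⟩ := H (fun t i => z (t, i)) fun t S hS => hz _ (Or.inr ⟨t, S, hS, rfl⟩)
  exact hzV (hz V (Or.inl hV))

theorem exists_forall_notMem_of_single (h : IsCompleteFamily A 𝒮) (hκ : ℵ₀ < κ)
    (hM : IsSaturated L M κ) (hι : IsSmall κ ι) {B : Set (ImElt L M)} (hB : IsSmall κ B)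
    (hAB : A ⊆ B) {𝒱 : Set (Set (ι → ImElt L M))}
    (hd : ∀ V ∈ 𝒱, B.Definable (imLanguage L M) V) (hne : 𝒱.Nonempty)
    (hdir : ∀ V ∈ 𝒱, ∀ W ∈ 𝒱, ∃ U ∈ 𝒱, U ⊆ V ∩ W)
    (H : ∀ z ∈ ⋂₀ 𝒮, ∃ V ∈ 𝒱, z ∉ V) : ∃ V ∈ 𝒱, ∃ S ∈ 𝒮, ∀ z ∈ S, z ∉ V := by
  let f : Set (ι → ImElt L M) → Set (Unit × ι → ImElt L M) := fun V => {z | (fun i => z ((), i)) ∈ V}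
  obtain ⟨_, ⟨V, hV, rfl⟩, S, hS, hVS⟩ := h.exists_forall_notMem hκ hM hι hB hAB (T := Unit)
    (𝒱 := f '' 𝒱)
    (by
      rintro _ ⟨V, hV, rfl⟩
      exact (hd V hV).preimage_comp (Prod.mk ()))
    (hne.image f)
    (by
      rintro _ ⟨V, hV, rfl⟩ _ ⟨W, hW, rfl⟩
      obtain ⟨U, hU, hUVW⟩ := hdir V hV W hW
      exact ⟨_, ⟨U, hU, rfl⟩, fun z hz => hUVW hz⟩)
    (fun z hz => by
      obtain ⟨V, hV, hz'⟩ := H (z ()) (hz ())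
      exact ⟨_, ⟨V, hV, rfl⟩, hz'⟩)
  exact ⟨V, hV, S, hS, fun z hz => hVS (fun _ => z) fun _ => hz⟩

theorem sInter_nonempty (h : IsCompleteFamily A 𝒮) (hκ : ℵ₀ < κ) (hM : IsSaturated L M κ)
    (hA : IsSmall κ A) (hι : IsSmall κ ι) : (⋂₀ 𝒮).Nonempty := by
  by_contra hne
  obtain ⟨V, rfl, S, hS, hS'⟩ := h.exists_forall_notMem_of_single hκ hM hι hA le_rfl
    (𝒱 := {Set.univ}) (by simp) (by simp) (by simp) fun z hz => (hne ⟨z, hz⟩).elim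
  obtain ⟨z, hz⟩ := h.nonempty S hS
  exact hS' z hz trivial

/-- Every realization of the restriction of a complete type extends to a realization. -/
theorem exists_extension (h : IsCompleteFamily A 𝒮) (hκ : ℵ₀ < κ) (hM : IsSaturated L M κ)
    (hA : IsSmall κ A) (hι : IsSmall κ ι) (F : Finset ι) {b : F → ImElt L M}
    (hb : ∀ S : Set (F → ImElt L M), A.Definable (imLanguage L M) S →
      {z | (fun i : F => z i) ∈ S} ∈ 𝒮 → b ∈ S) :
    ∃ z ∈ ⋂₀ 𝒮, ∀ i : F, z i = b i := by
  by_contra! hne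
  have hB : IsSmall κ (A ∪ Set.range b : Set (ImElt L M)) :=
    hA.union hκ ((isSmall_of_countable hκ F).range b)
  obtain ⟨V, rfl, S, hS, hS'⟩ := h.exists_forall_notMem_of_single hκ hM hι hB
    Set.subset_union_left (𝒱 := {{z | ∀ i : F, z i = b i}})
    (by
      rintro _ rfl
      have := Set.definable_iInter_of_finite fun i : F =>
        definable_eq_const (L := imLanguage L M) (B := A ∪ Set.range b) (Or.inr ⟨i, rfl⟩) (i : ι)
      convert this using 1
      ext z
      simp)
    (by simp) (by simp) (fun z hz => ⟨_, rfl, fun h' => by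
      obtain ⟨i, hi⟩ := hne z hz
      exact hi (h' i)⟩)
  -- The projection of `S` is `A`-definable and belongs to the restricted type, so it contains `b`,
  -- although no point of `S` extends `b`.
  have hd : A.Definable (imLanguage L M) {z : F → ImElt L M | ∃ t ∈ S, ∀ i : F, t i = z i} := by
    have h₁ := (h.definable S hS).preimage_comp (Sum.inr : ι → F ⊕ ι)
    have h₂ := Set.definable_iInter_of_finite fun i : F =>
      definable_eq (L := imLanguage L M) A (Sum.inr i : F ⊕ ι) (Sum.inl i)
    convert definable_exists (h₁.inter h₂) using 1
    ext z
    refine exists_congr fun t => and_congr Iff.rfl ?_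
    simp
  obtain ⟨t, ht, ht'⟩ := hb _ hd (h.mem_of_subset hS (hd.preimage_comp ((↑) : F → ι))
    fun t ht => ⟨t, ht, fun i => rfl⟩)
  exact hS' t ht ht'

/-- A definable relation which is an equivalence relation on the realizations of a complete type,
is one on some set of the type. -/
theorem exists_mem_equivalence (h : IsCompleteFamily A 𝒮) (hκ : ℵ₀ < κ) (hM : IsSaturated L M κ)
    (hA : IsSmall κ A) (hι : IsSmall κ ι) {D : Set (ι ⊕ ι → ImElt L M)}
    (hD : A.Definable (imLanguage L M) D) (hrefl : ∀ a ∈ ⋂₀ 𝒮, Sum.elim a a ∈ D)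
    (hsymm : ∀ a ∈ ⋂₀ 𝒮, ∀ b ∈ ⋂₀ 𝒮, Sum.elim a b ∈ D → Sum.elim b a ∈ D)
    (htrans : ∀ a ∈ ⋂₀ 𝒮, ∀ b ∈ ⋂₀ 𝒮, ∀ c ∈ ⋂₀ 𝒮, Sum.elim a b ∈ D → Sum.elim b c ∈ D →
      Sum.elim a c ∈ D) :
    ∃ S ∈ 𝒮, (∀ a ∈ S, Sum.elim a a ∈ D) ∧
      (∀ a ∈ S, ∀ b ∈ S, Sum.elim a b ∈ D → Sum.elim b a ∈ D) ∧
      ∀ a ∈ S, ∀ b ∈ S, ∀ c ∈ S, Sum.elim a b ∈ D → Sum.elim b c ∈ D → Sum.elim a c ∈ D := by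
  let d : Fin 3 → Fin 3 → Set (Fin 3 × ι → ImElt L M) := fun i j =>
    {z | z ∘ Sum.elim (Prod.mk i) (Prod.mk j) ∈ D}
  have hd (i j : Fin 3) : A.Definable (imLanguage L M) (d i j) :=
    hD.preimage_comp (Sum.elim (Prod.mk i) (Prod.mk j))
  have hdz (z : Fin 3 → ι → ImElt L M) (i j : Fin 3) :
      (fun q : Fin 3 × ι => z q.1 q.2) ∈ d i j ↔ Sum.elim (z i) (z j) ∈ D := by
    simp only [d, Set.mem_ofPred_eq, Sum.comp_elim]
    exact Iff.rfl
  obtain ⟨_, rfl, S, hS, hS'⟩ := h.exists_forall_notMem hκ hM hι hA le_rfl (T := Fin 3)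
    -- The triples violating one of the three axioms. No triple of realizations does, so by
    -- compactness no triple from some `S` does.
    (𝒱 := {(d 0 0 ∩ ((d 0 1)ᶜ ∪ d 1 0) ∩ ((d 0 1)ᶜ ∪ ((d 1 2)ᶜ ∪ d 0 2)))ᶜ})
    (by
      rintro _ rfl
      exact (((hd 0 0).inter ((hd 0 1).compl.union (hd 1 0))).inter
        ((hd 0 1).compl.union ((hd 1 2).compl.union (hd 0 2)))).compl)
    (by simp) (by simp)
    (fun z hz => ⟨_, rfl, by
      simp only [Set.mem_compl_iff, Set.mem_inter_iff, Set.mem_union, hdz, not_not,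
        ← imp_iff_not_or]
      exact ⟨⟨hrefl _ (hz 0), hsymm _ (hz 0) _ (hz 1)⟩, htrans _ (hz 0) _ (hz 1) _ (hz 2)⟩⟩)
  have key (a : ι → ImElt L M) (ha : a ∈ S) (b : ι → ImElt L M) (hb : b ∈ S) (c : ι → ImElt L M)
      (hc : c ∈ S) := hS' ![a, b, c] (by simp [Fin.forall_fin_succ, ha, hb, hc])
  simp only [Set.mem_compl_iff, Set.mem_inter_iff, Set.mem_union, hdz, not_not,
    ← imp_iff_not_or] at key
  exact ⟨S, hS, fun a ha => (key a ha a ha a ha).1.1, fun a ha b hb => (key a ha b hb b hb).1.2,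
    fun a ha b hb c hc => (key a ha b hb c hc).2⟩

/-- A definable relation which has boundedly many classes on the realizations of a complete type
has finitely many. -/
theorem exists_finset_cover (h : IsCompleteFamily A 𝒮) (hκ : ℵ₀ < κ) (hM : IsSaturated L M κ)
    (hA : IsSmall κ A) (hι : IsSmall κ ι) {D : Set (ι ⊕ ι → ImElt L M)}
    (hD : A.Definable (imLanguage L M) D) {T : Set (ι → ImElt L M)} (hT : IsSmall κ T)
    (hcov : ∀ a ∈ ⋂₀ 𝒮, ∃ t ∈ T, Sum.elim t a ∈ D) :
    ∃ T₀ : Finset (ι → ImElt L M), ↑T₀ ⊆ T ∧ ∃ S ∈ 𝒮, ∀ a ∈ S, ∃ t ∈ T₀, Sum.elim t a ∈ D := by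
  classical
  let B : Set (ImElt L M) := A ∪ Set.range fun q : T × ι => q.1.1 q.2
  have hB : IsSmall κ B := hA.union hκ ((hT.prod hκ hι).range _)
  let V : Finset (ι → ImElt L M) → Set (ι → ImElt L M) := fun T₀ => {a | ∀ t ∈ T₀, a ∈ {a | Sum.elim t a ∈ D}ᶜ}
  obtain ⟨_, ⟨T₀, hT₀, rfl⟩, S, hS, hS'⟩ := h.exists_forall_notMem_of_single hκ hM hι hB
    Set.subset_union_left (𝒱 := V '' {T₀ | ↑T₀ ⊆ T})
    (by
      rintro _ ⟨T₀, hT₀, rfl⟩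
      refine definable_forall_mem_finset T₀ fun t ht => (definable_fiber hD Set.subset_union_left t
        fun i => ?_).compl
      exact Or.inr ⟨(⟨t, hT₀ ht⟩, i), rfl⟩)
    ⟨V ∅, ∅, by simp, rfl⟩
    (by
      rintro _ ⟨T₀, hT₀, rfl⟩ _ ⟨T₁, hT₁, rfl⟩
      refine ⟨_, ⟨T₀ ∪ T₁, by simpa using ⟨hT₀, hT₁⟩, rfl⟩, fun a ha => ⟨fun t ht => ?_, fun t ht => ?_⟩⟩
      · exact ha t (Finset.mem_union_left _ ht)
      · exact ha t (Finset.mem_union_right _ ht))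
    (fun a ha => by
      obtain ⟨t, ht, hta⟩ := hcov a ha
      exact ⟨_, ⟨{t}, by simpa using ht, rfl⟩, fun h' => h' t (by simp) hta⟩)
  refine ⟨T₀, hT₀, S, hS, fun a ha => ?_⟩
  by_contra! hcon
  exact hS' a ha hcon

/-- Over an algebraically closed set, a relatively definable equivalence relation with boundedly
many classes on the realizations of a complete type in finitely many variables is trivial. -/
theorem mem_of_bounded_of_finite [Finite ι] (h : IsCompleteFamily A 𝒮) (hκ : ℵ₀ < κ)
    (hM : IsSaturated L M κ) (hA : IsSmall κ A) (hacl : acleq A = A)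
    {D : Set (ι ⊕ ι → ImElt L M)} (hD : A.Definable (imLanguage L M) D)
    (hrefl : ∀ a ∈ ⋂₀ 𝒮, Sum.elim a a ∈ D)
    (hsymm : ∀ a ∈ ⋂₀ 𝒮, ∀ b ∈ ⋂₀ 𝒮, Sum.elim a b ∈ D → Sum.elim b a ∈ D)
    (htrans : ∀ a ∈ ⋂₀ 𝒮, ∀ b ∈ ⋂₀ 𝒮, ∀ c ∈ ⋂₀ 𝒮, Sum.elim a b ∈ D → Sum.elim b c ∈ D →
      Sum.elim a c ∈ D) {T : Set (ι → ImElt L M)} (hTsub : T ⊆ ⋂₀ 𝒮) (hT : IsSmall κ T)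
    (hcov : ∀ a ∈ ⋂₀ 𝒮, ∃ t ∈ T, Sum.elim t a ∈ D) {a b : ι → ImElt L M} (ha : a ∈ ⋂₀ 𝒮)
    (hb : b ∈ ⋂₀ 𝒮) : Sum.elim a b ∈ D := by
  have hι : IsSmall κ ι := isSmall_of_countable hκ ι
  obtain ⟨S₁, hS₁, hr, hs, ht⟩ := h.exists_mem_equivalence hκ hM hA hι hD hrefl hsymm htrans
  obtain ⟨T₀, hT₀, S₂, hS₂, hcov₀⟩ := h.exists_finset_cover hκ hM hA hι hD hT hcov
  choose σ hσ using h.sort_mem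
  have hS₃ : {z : ι → ImElt L M | ∀ i, (z i).1 = σ i} ∈ 𝒮 := by
    refine (h.mem_iff ha ?_).2 fun i => ha _ (hσ i)
    convert Set.definable_iInter_of_finite fun i => h.definable _ (hσ i) using 1
    ext z
    simp
  let S := S₁ ∩ S₂ ∩ {z : ι → ImElt L M | ∀ i, (z i).1 = σ i}
  have hS : S ∈ 𝒮 := h.inter_mem _ (h.inter_mem _ hS₁ _ hS₂) _ hS₃
  have hSd := h.definable S hS
  -- For `z` in `S`, `c z` codes the class of `z` within `S`.
  obtain ⟨c, G, hG, hcG, hc⟩ := exists_code σ σ ((hSd.preimage_comp Sum.inr).inter hD)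
  have hceq (z z' : ι → ImElt L M) (hz : z ∈ S) (hz' : z' ∈ S) (hzz' : Sum.elim z z' ∈ D) :
      c z = c z' := by
    refine (hc z z' hz.2 hz'.2).2 fun t _ => and_congr_right fun hts => ⟨fun hzt => ?_, fun hzt => ?_⟩
    · exact ht _ hz'.1.1 _ hz.1.1 _ hts.1.1 (hs _ hz.1.1 _ hz'.1.1 hzz') hzt
    · exact ht _ hz.1.1 _ hz'.1.1 _ hts.1.1 hzz' hzt
  -- The codes of points of `S` form an `A`-definable set, finite because each class in `S` has a
  -- representative in `T₀`.
  have hacl' : c a ∈ acleq A := by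
    refine ⟨{e | ∃ z, Sum.elim z (fun _ => e) ∈ G ∧ z ∈ S}, ?_, ?_, a, ?_, ha S hS⟩
    · rw [Set.Definable₁]
      have h₁ := hG.preimage_comp (β := Fin 1 ⊕ ι) (Sum.elim Sum.inr fun _ => Sum.inl 0)
      convert definable_exists (h₁.inter (hSd.preimage_comp Sum.inr)) using 1
      ext e
      refine exists_congr fun z => and_congr ?_ Iff.rfl
      rw [Set.mem_preimage, Sum.comp_elim]
      exact Iff.rfl
    · refine (T₀.finite_toSet.image c).subset ?_
      rintro e ⟨z, hze, hz⟩
      rw [hcG z hz.2] at hze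
      obtain ⟨t, htT, htz⟩ := hcov₀ z hz.1.2
      exact ⟨t, htT, (hceq t z (hTsub (hT₀ htT) S hS) hz htz).trans hze.symm⟩
    · exact (hcG a (ha _ hS₃) _).2 rfl
  rw [hacl] at hacl'
  -- With its code in `A`, having the same code as `a` is an `A`-definable property; it holds of
  -- `a`, hence of `b`.
  have hfib : A.Definable (imLanguage L M) {z : ι → ImElt L M | Sum.elim z (fun _ => c a) ∈ G} := by
    have h₁ := definable_fiber (hG.preimage_comp (Equiv.sumComm ι Unit)) le_rfl (fun _ => c a)
      fun _ => hacl'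
    convert h₁ using 1
    ext z
    rw [Set.mem_ofPred_eq, Set.mem_ofPred_eq, Set.mem_preimage]
    refine iff_of_eq (congrArg (· ∈ G) ?_)
    ext1 (_ | _) <;> rfl
  have hmem := (h.mem_iff ha hfib).2 ((hcG a (ha _ hS₃) _).2 rfl)
  have hcab : c a = c b := (hcG b (hb _ hS₃) _).1 (hb _ hmem)
  exact (((hc a b (ha _ hS₃) (hb _ hS₃)).1 hcab b (hb _ hS₃)).2 ⟨hb _ hS, hrefl b hb⟩).2

/-- Over an algebraically closed set, a relatively definable equivalence relation with boundedly
many classes on the realizations of a complete type is trivial. -/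
theorem mem_of_bounded (h : IsCompleteFamily A 𝒮) (hκ : ℵ₀ < κ)
    (hM : IsSaturated L M κ) (hA : IsSmall κ A) (hι : IsSmall κ ι) (hacl : acleq A = A)
    {D : Set (ι ⊕ ι → ImElt L M)} (hD : A.Definable (imLanguage L M) D)
    (hrefl : ∀ a ∈ ⋂₀ 𝒮, Sum.elim a a ∈ D)
    (hsymm : ∀ a ∈ ⋂₀ 𝒮, ∀ b ∈ ⋂₀ 𝒮, Sum.elim a b ∈ D → Sum.elim b a ∈ D)
    (htrans : ∀ a ∈ ⋂₀ 𝒮, ∀ b ∈ ⋂₀ 𝒮, ∀ c ∈ ⋂₀ 𝒮, Sum.elim a b ∈ D → Sum.elim b c ∈ D →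
      Sum.elim a c ∈ D) {T : Set (ι → ImElt L M)} (hTsub : T ⊆ ⋂₀ 𝒮) (hT : IsSmall κ T)
    (hcov : ∀ a ∈ ⋂₀ 𝒮, ∃ t ∈ T, Sum.elim t a ∈ D) {a b : ι → ImElt L M} (ha : a ∈ ⋂₀ 𝒮)
    (hb : b ∈ ⋂₀ 𝒮) : Sum.elim a b ∈ D := by
  classical
  obtain ⟨F', D', hD', hDD'⟩ := exists_finset_definable hD
  -- The variables on which `D` depends, on either side. Realizations of the restriction to `F` lift
  -- to realizations of the whole type, so all hypotheses pass to the finite tuple.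
  let F : Finset ι := F'.toLeft ∪ F'.toRight
  let f : F' → F ⊕ F := fun i => match i with
    | ⟨Sum.inl j, hj⟩ => Sum.inl ⟨j, Finset.mem_union_left _ (by simpa using hj)⟩
    | ⟨Sum.inr j, hj⟩ => Sum.inr ⟨j, Finset.mem_union_right _ (by simpa using hj)⟩
  let D₀ : Set (F ⊕ F → ImElt L M) := {z | z ∘ f ∈ D'}
  have hD₀ : A.Definable (imLanguage L M) D₀ := hD'.preimage_comp f
  let res : (ι → ImElt L M) → F → ImElt L M := fun z i => z i
  have hDD₀ (z t : ι → ImElt L M) : Sum.elim (res z) (res t) ∈ D₀ ↔ Sum.elim z t ∈ D := by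
    rw [hDD', Set.mem_ofPred_eq]
    refine iff_of_eq (congrArg (· ∈ D') ?_)
    ext1 ⟨_ | _, _⟩ <;> rfl
  have h₀ := h.restrict F
  have hres (z : ι → ImElt L M) (hz : z ∈ ⋂₀ 𝒮) : res z ∈ ⋂₀ {S : Set (F → ImElt L M) |
      A.Definable (imLanguage L M) S ∧ {z : ι → ImElt L M | (fun i : F => z i) ∈ S} ∈ 𝒮} :=
    fun S hS => hz _ hS.2
  have hext (z : F → ImElt L M) (hz : z ∈ ⋂₀ {S : Set (F → ImElt L M) |
      A.Definable (imLanguage L M) S ∧ {z : ι → ImElt L M | (fun i : F => z i) ∈ S} ∈ 𝒮}) :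
      ∃ t ∈ ⋂₀ 𝒮, res t = z := by
    obtain ⟨t, ht, ht'⟩ := h.exists_extension hκ hM hA hι F (b := z) fun S hS hS' => hz S ⟨hS, hS'⟩
    exact ⟨t, ht, funext ht'⟩
  rw [← hDD₀]
  refine h₀.mem_of_bounded_of_finite hκ hM hA hacl hD₀ ?_ ?_ ?_ (T := res '' T) ?_ ?_ ?_
    (hres a ha) (hres b hb)
  · intro z hz
    obtain ⟨z, hz', rfl⟩ := hext z hz
    exact (hDD₀ z z).2 (hrefl z hz')
  · intro z hz t ht
    obtain ⟨z, hz', rfl⟩ := hext z hz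
    obtain ⟨t, ht', rfl⟩ := hext t ht
    rw [hDD₀, hDD₀]
    exact hsymm z hz' t ht'
  · intro z hz t ht s hs
    obtain ⟨z, hz', rfl⟩ := hext z hz
    obtain ⟨t, ht', rfl⟩ := hext t ht
    obtain ⟨s, hs', rfl⟩ := hext s hs
    rw [hDD₀, hDD₀, hDD₀]
    exact htrans z hz' t ht' s hs'
  · rintro _ ⟨t, ht, rfl⟩
    exact hres t (hTsub ht)
  · exact hT.of_surjective (fun t => ⟨res t, t, t.2, rfl⟩) (by
      rintro ⟨_, t, ht, rfl⟩
      exact ⟨⟨t, ht⟩, rfl⟩)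
  · intro z hz
    obtain ⟨z, hz', rfl⟩ := hext z hz
    obtain ⟨t, ht, htz⟩ := hcov z hz'
    exact ⟨_, ⟨t, ht, rfl⟩, (hDD₀ t z).2 htz⟩

end IsCompleteFamily

/-! ### Entourages and the case of continuum many classes. -/

/-- An `A`-definable relation which contains `E`. -/
def IsEntourage (A : Set (ImElt L M)) {ι : Type x} {P : Set (ι → ImElt L M)} (E : Setoid P)
    (U : Set (ι ⊕ ι → ImElt L M)) : Prop :=
  A.Definable (imLanguage L M) U ∧ ∀ a b : P, E a b → Sum.elim a.1 b.1 ∈ U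

theorem elim_comp_swap {α β γ : Type*} (f : α → γ) (g : β → γ) :
    Sum.elim f g ∘ Sum.swap = Sum.elim g f := by
  ext1 (_ | _) <;> rfl

section

variable {A : Set (ImElt L M)} {ι : Type x} {P : Set (ι → ImElt L M)} {E : Setoid P}
  {U V : Set (ι ⊕ ι → ImElt L M)}

theorem IsEntourage.inter (hU : IsEntourage A E U) (hV : IsEntourage A E V) :
    IsEntourage A E (U ∩ V) :=
  ⟨hU.1.inter hV.1, fun a b h => ⟨hU.2 a b h, hV.2 a b h⟩⟩

theorem isEntourage_univ : IsEntourage A E Set.univ :=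
  ⟨Set.definable_univ, fun _ _ _ => trivial⟩

theorem IsEntourage.swap (hU : IsEntourage A E U) :
    IsEntourage A E {z | z ∘ Sum.swap ∈ U} := by
  refine ⟨hU.1.preimage_comp Sum.swap, fun a b h => ?_⟩
  have := hU.2 b a (E.symm h)
  rwa [Set.mem_ofPred_eq, elim_comp_swap]

end

namespace IsCompleteFamily

variable {A : Set (ImElt L M)} {ι : Type x} {𝒮 : Set (Set (ι → ImElt L M))} [Nonempty M]
  {E : Setoid (⋂₀ 𝒮)}

/-- A triple with both links in every entourage has `E`-equivalent ends by transitivity, so its ends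
are related by `U`. Compactness replaces all entourages by one, and intersecting with the converse
makes it symmetric. -/
theorem exists_half (h : IsCompleteFamily A 𝒮) (hκ : ℵ₀ < κ) (hM : IsSaturated L M κ)
    (hA : IsSmall κ A) (hι : IsSmall κ ι)
    (hE : ∀ a b : ⋂₀ 𝒮, (∀ U, IsEntourage A E U → Sum.elim a.1 b.1 ∈ U) → E a b)
    {U : Set (ι ⊕ ι → ImElt L M)} (hU : IsEntourage A E U) :
    ∃ V, IsEntourage A E V ∧ (∀ a b : ⋂₀ 𝒮, Sum.elim a.1 b.1 ∈ V → Sum.elim b.1 a.1 ∈ V) ∧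
      ∀ a b c : ⋂₀ 𝒮, Sum.elim a.1 b.1 ∈ V → Sum.elim b.1 c.1 ∈ V → Sum.elim a.1 c.1 ∈ U := by
  let d : Set (ι ⊕ ι → ImElt L M) → Fin 3 → Fin 3 → Set (Fin 3 × ι → ImElt L M) := fun V i j =>
    {z | z ∘ Sum.elim (Prod.mk i) (Prod.mk j) ∈ V}
  have hd (V : Set (ι ⊕ ι → ImElt L M)) (hV : A.Definable (imLanguage L M) V) (i j : Fin 3) :
      A.Definable (imLanguage L M) (d V i j) :=
    hV.preimage_comp (Sum.elim (Prod.mk i) (Prod.mk j))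
  have hdz (V : Set (ι ⊕ ι → ImElt L M)) (z : Fin 3 → ι → ImElt L M) (i j : Fin 3) :
      (fun q : Fin 3 × ι => z q.1 q.2) ∈ d V i j ↔ Sum.elim (z i) (z j) ∈ V := by
    simp only [d, Set.mem_ofPred_eq, Sum.comp_elim]
    exact Iff.rfl
  obtain ⟨_, ⟨V, hV, rfl⟩, S, hS, hS'⟩ := h.exists_forall_notMem hκ hM hι hA le_rfl (T := Fin 3)
    (𝒱 := (fun V => (d V 0 1 ∩ d V 1 2) ∩ (d U 0 2)ᶜ) '' {V | IsEntourage A E V})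
    (by
      rintro _ ⟨V, hV, rfl⟩
      exact ((hd V hV.1 0 1).inter (hd V hV.1 1 2)).inter (hd U hU.1 0 2).compl)
    ⟨_, Set.univ, isEntourage_univ, rfl⟩
    (by
      rintro _ ⟨V, hV, rfl⟩ _ ⟨W, hW, rfl⟩
      refine ⟨_, ⟨V ∩ W, hV.inter hW, rfl⟩, fun z hz => ⟨⟨⟨?_, ?_⟩, hz.2⟩, ⟨?_, ?_⟩, hz.2⟩⟩
      exacts [hz.1.1.1, hz.1.2.1, hz.1.1.2, hz.1.2.2])
    (fun z hz => by
      by_contra! hcon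
      have h₁ (V) (hV : IsEntourage A E V) : Sum.elim (z 0) (z 1) ∈ V ∧ Sum.elim (z 1) (z 2) ∈ V ∧
          Sum.elim (z 0) (z 2) ∉ U := by
        have := hcon _ ⟨V, hV, rfl⟩
        rw [Set.mem_inter_iff, Set.mem_inter_iff, Set.mem_compl_iff, hdz, hdz, hdz] at this
        exact ⟨this.1.1, this.1.2, this.2⟩
      have h₂ := hE ⟨z 0, hz 0⟩ ⟨z 1, hz 1⟩ fun V hV => (h₁ V hV).1
      have h₃ := hE ⟨z 1, hz 1⟩ ⟨z 2, hz 2⟩ fun V hV => (h₁ V hV).2.1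
      exact (h₁ _ isEntourage_univ).2.2 (hU.2 _ _ (E.trans h₂ h₃)))
  have hsw (a b : ι → ImElt L M) : Sum.elim a b ∈ {z | z ∘ Sum.swap ∈ V} ↔ Sum.elim b a ∈ V := by
    rw [Set.mem_ofPred_eq, elim_comp_swap]
  refine ⟨V ∩ {z | z ∘ Sum.swap ∈ V}, hV.inter hV.swap, fun a b hab => ?_, fun a b c hab hbc => ?_⟩
  · rw [Set.mem_inter_iff, hsw] at hab ⊢
    exact hab.symm
  · have := hS' ![a.1, b.1, c.1] (by
      simp only [Fin.forall_fin_succ]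
      exact ⟨a.2 S hS, b.2 S hS, c.2 S hS, fun i => i.elim0⟩)
    rw [Set.mem_inter_iff, Set.mem_inter_iff, Set.mem_compl_iff, hdz, hdz, hdz] at this
    by_contra hac
    exact this ⟨⟨hab.1, hbc.1⟩, hac⟩

/-- If an entourage contains a pair of inequivalent realizations, then it contains such a pair
whose first entry is any given realization. -/
theorem exists_mem_entourage (h : IsCompleteFamily A 𝒮) (hκ : ℵ₀ < κ) (hM : IsSaturated L M κ)
    (hA : IsSmall κ A) (hι : IsSmall κ ι)
    (hE : ∀ a b : ⋂₀ 𝒮, (∀ U, IsEntourage A E U → Sum.elim a.1 b.1 ∈ U) → E a b)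
    {U : Set (ι ⊕ ι → ImElt L M)} (hU : IsEntourage A E U) {a b : ⋂₀ 𝒮}
    (hab : Sum.elim a.1 b.1 ∈ U) (hab' : ¬ E a b) (c : ⋂₀ 𝒮) :
    ∃ d : ⋂₀ 𝒮, Sum.elim c.1 d.1 ∈ U ∧ ¬ E c d := by
  obtain ⟨V, hV, hVab⟩ : ∃ V, IsEntourage A E V ∧ Sum.elim a.1 b.1 ∉ V := by
    by_contra! hcon
    exact hab' (hE a b hcon)
  have hUV := hU.1.inter hV.1.compl
  by_contra! hcon
  obtain ⟨_, rfl, S, hS, hS'⟩ := h.exists_forall_notMem_of_single hκ hM hι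
    (hA.union hκ (hι.range c.1)) Set.subset_union_left (𝒱 := {{z | Sum.elim c.1 z ∈ U ∩ Vᶜ}})
    (by
      rintro _ rfl
      exact definable_fiber hUV Set.subset_union_left c.1 fun i => Or.inr ⟨i, rfl⟩)
    (by simp) (by simp)
    (fun z hz => ⟨_, rfl, fun hz' => hz'.2 (hV.2 c ⟨z, hz⟩ (hcon ⟨z, hz⟩ hz'.1))⟩)
  -- Having a partner in `S` related by `U` but not by `V` is an `A`-definable property of the first
  -- entry; it passes from `a` to `c`, contradicting the choice of `S`.
  have hd := definable_exists (hUV.inter ((h.definable S hS).preimage_comp Sum.inr))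
  have hmem := (h.mem_iff a.2 hd).2 ⟨b.1, ⟨hab, hVab⟩, b.2 S hS⟩
  obtain ⟨z, hz, hzS⟩ := c.2 _ hmem
  exact hS' z hzS hz

/-- If no entourage is contained in a type-definable equivalence relation `E` on the realizations
of a complete type, then `E` has at least continuum many classes. -/
theorem two_power_aleph0_le (h : IsCompleteFamily A 𝒮) (hκ : ℵ₀ < κ) (hM : IsSaturated L M κ)
    (hA : IsSmall κ A) (hι : IsSmall κ ι)
    (hE : ∀ a b : ⋂₀ 𝒮, (∀ U, IsEntourage A E U → Sum.elim a.1 b.1 ∈ U) → E a b)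
    (hU : ∀ U, IsEntourage A E U → ∃ a b : ⋂₀ 𝒮, Sum.elim a.1 b.1 ∈ U ∧ ¬ E a b) :
    2 ^ ℵ₀ ≤ #(Quotient E) := by
  obtain ⟨a₀, ha₀⟩ := h.sInter_nonempty hκ hM hA hι
  let N := ↥(⋂₀ 𝒮) × {U : Set (ι ⊕ ι → ImElt L M) // IsEntourage A E U}
  have : Nonempty N := ⟨⟨⟨a₀, ha₀⟩, Set.univ, isEntourage_univ⟩⟩
  let ball : N → Set (⋂₀ 𝒮) := fun n => {z | Sum.elim n.1.1 z.1 ∈ n.2.1}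
  have hcenter (n : N) : n.1 ∈ ball n := n.2.2.2 _ _ (E.refl _)
  have hsplit (n : N) : ∃ n₁ n₂ : N, ball n₁ ⊆ ball n ∧ ball n₂ ⊆ ball n ∧
      ∀ a ∈ ball n₁, ∀ b ∈ ball n₂, ¬ E a b := by
    obtain ⟨a, U, hUE⟩ := n
    obtain ⟨V, hV, hVs, hVU⟩ := h.exists_half hκ hM hA hι hE hUE
    obtain ⟨c, d, hcd, hcd'⟩ := hU V hV
    obtain ⟨b, hab, hab'⟩ := h.exists_mem_entourage hκ hM hA hι hE hV hcd hcd' a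
    obtain ⟨W, hW, hWab⟩ : ∃ W, IsEntourage A E W ∧ Sum.elim a.1 b.1 ∉ W := by
      by_contra! hcon
      exact hab' (hE a b hcon)
    -- Equivalent points `z`, `t` of the two balls would give a chain `a, z, t, b`. Its three links
    -- require two halvings of `W`, the last link being padded by the trivial pair `(b, b)`.
    obtain ⟨W₁, hW₁, hWs₁, hWW₁⟩ := h.exists_half hκ hM hA hι hE hW
    obtain ⟨W₂, hW₂, hWs₂, hWW₂⟩ := h.exists_half hκ hM hA hι hE hW₁
    have hr (V) (hV : IsEntourage A E V) (a : ⋂₀ 𝒮) : Sum.elim a.1 a.1 ∈ V := hV.2 a a (E.refl a)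
    refine ⟨⟨a, V ∩ W₂, hV.inter hW₂⟩, ⟨b, V ∩ W₂, hV.inter hW₂⟩, fun z hz => ?_, fun z hz => ?_,
      fun z hz t ht hzt => ?_⟩
    · exact hVU a a z (hr V hV a) hz.1
    · exact hVU a b z hab hz.1
    · have h₁ := hWW₂ a z t hz.2 (hW₂.2 z t hzt)
      have h₂ := hWW₂ t b b (hWs₂ b t ht.2) (hr _ hW₂ b)
      exact hWab (hWW₁ a t b h₁ h₂)
  choose n₁ n₂ hn₁ hn₂ hn using hsplit
  refine two_power_aleph0_le_mk_quotient E ball (fun n b => cond b (n₁ n) (n₂ n)) ?_ hn ?_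
  · rintro n (_ | _)
    exacts [hn₂ n, hn₁ n]
  intro f hf
  have hanti : Antitone fun k => ball (f k) := antitone_nat_of_succ_le hf
  by_contra! hcon
  let B : Set (ImElt L M) := A ∪ Set.range fun q : ℕ × ι => (f q.1).1.1 q.2
  have hB : IsSmall κ B := hA.union hκ (((isSmall_of_countable hκ ℕ).prod hκ hι).range _)
  let V : ℕ → Set (ι → ImElt L M) := fun n =>
    {z | ∀ k ∈ Finset.range (n + 1), z ∈ {z | Sum.elim (f k).1.1 z ∈ (f k).2.1}}
  obtain ⟨_, ⟨n, rfl⟩, S, hS, hS'⟩ := h.exists_forall_notMem_of_single hκ hM hι hB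
    Set.subset_union_left (𝒱 := Set.range V)
    (by
      rintro _ ⟨n, rfl⟩
      exact definable_forall_mem_finset _ fun k _ => definable_fiber (f k).2.2.1
        Set.subset_union_left _ fun i => Or.inr ⟨(k, i), rfl⟩)
    (Set.range_nonempty V)
    (by
      rintro _ ⟨m, rfl⟩ _ ⟨n, rfl⟩
      refine ⟨_, ⟨max m n, rfl⟩, fun z hz => ⟨fun k hk => hz k ?_, fun k hk => hz k ?_⟩⟩ <;>
        simp only [Finset.mem_range] at hk ⊢ <;> omega)
    (fun z hz => by
      obtain ⟨k, hk⟩ := hcon ⟨z, hz⟩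
      exact ⟨_, ⟨k, rfl⟩, fun hz' => hk (hz' k (by simp))⟩)
  -- The centre of the `n`-th ball lies in all the earlier balls, since they are nested; this is the
  -- finite satisfiability that saturation needs.
  refine hS' (f n).1.1 ((f n).1.2 S hS) fun k hk => ?_
  exact hanti (by simpa [Nat.lt_succ_iff] using hk) (hcenter (f n))

/-- The dichotomy is whether some entourage coincides with `E` on the realizations, that is, whether
`E` is relatively definable. -/
theorem mk_quotient_eq_one_or_le (h : IsCompleteFamily A 𝒮) (hκ : ℵ₀ < κ) (hM : IsSaturated L M κ)
    (hA : IsSmall κ A) (hacl : acleq A = A) (hι : IsSmall κ ι)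
    (hE : ∀ a b : ⋂₀ 𝒮, (∀ U, IsEntourage A E U → Sum.elim a.1 b.1 ∈ U) → E a b)
    (hbdd : IsSmall κ (Quotient E)) : #(Quotient E) = 1 ∨ 2 ^ ℵ₀ ≤ #(Quotient E) := by
  by_cases hU : ∀ U, IsEntourage A E U → ∃ a b : ⋂₀ 𝒮, Sum.elim a.1 b.1 ∈ U ∧ ¬ E a b
  · exact Or.inr (h.two_power_aleph0_le hκ hM hA hι hE hU)
  left
  push Not at hU
  obtain ⟨U, hUE, hU⟩ := hU
  obtain ⟨a₀, ha₀⟩ := h.sInter_nonempty hκ hM hA hι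
  rw [Cardinal.eq_one_iff_unique]
  refine ⟨⟨fun q r => ?_⟩, ⟨Quotient.mk E ⟨a₀, ha₀⟩⟩⟩
  induction q using Quotient.inductionOn with | h a => ?_
  induction r using Quotient.inductionOn with | h b => ?_
  refine Quotient.sound (hU a b ?_)
  refine h.mem_of_bounded hκ hM hA hι hacl hUE.1 (fun a ha => hUE.2 ⟨a, ha⟩ ⟨a, ha⟩ (E.refl _))
    (fun a ha b hb hab => hUE.2 ⟨b, hb⟩ ⟨a, ha⟩ (E.symm (hU ⟨a, ha⟩ ⟨b, hb⟩ hab)))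
    (fun a ha b hb c hc hab hbc => hUE.2 ⟨a, ha⟩ ⟨c, hc⟩
      (E.trans (hU ⟨a, ha⟩ ⟨b, hb⟩ hab) (hU ⟨b, hb⟩ ⟨c, hc⟩ hbc)))
    -- One representative for each class: a small covering set, by boundedness.
    (T := Set.range fun q : Quotient E => q.out.1) ?_ (hbdd.range _) ?_ a.2 b.2
  · rintro _ ⟨q, rfl⟩
    exact q.out.2
  · exact fun a ha => ⟨_, ⟨Quotient.mk E ⟨a, ha⟩, rfl⟩, hUE.2 _ ⟨a, ha⟩ (Quotient.mk_out _)⟩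

end IsCompleteFamily

/-! ### Translation from complete types, and the theorem. -/

/-- The definable sets which are given by the formulas of a complete type. -/
def typeFamily [Nonempty M] {A : Set (ImElt L M)} {ι : Type x} (p : TypeOver A ι) :
    Set (Set (ι → ImElt L M)) :=
  {S | ∃ φ : ((imLanguage L M)[[A]]).Formula ι, Formula.equivSentence φ ∈ p ∧ S = Set.ofPred φ.Realize}

variable [Nonempty M] {A : Set (ImElt L M)} {ι : Type x}

theorem sInter_typeFamily (p : TypeOver A ι) : ⋂₀ typeFamily p = realizations p := by
  ext z
  constructor
  · intro hz
    refine SetLike.ext fun ψ => ?_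
    obtain ⟨φ, rfl⟩ := Formula.equivSentence.surjective ψ
    rw [Theory.CompleteType.formula_mem_typeOf]
    refine ⟨fun hφ => ?_, fun hφ => hz _ ⟨φ, hφ, rfl⟩⟩
    by_contra hφp
    have hnot := (p.mem_or_not_mem (Formula.equivSentence φ)).resolve_left hφp
    exact hz _ ⟨φ.not, hnot, rfl⟩ hφ
  · rintro rfl S ⟨φ, hφ, rfl⟩
    exact Theory.CompleteType.formula_mem_typeOf.1 hφ

/-- A realization `t` of `p` in some model `N` of the theory turns membership in `p` into truth at
`t`, from which closure and completeness are read off. -/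
theorem isCompleteFamily_typeFamily (p : TypeOver A ι) (hp : IsSorted p) :
    IsCompleteFamily A (typeFamily p) := by
  classical
  obtain ⟨N, t, ht⟩ := Theory.exists_modelType_is_realized_in _ p
  have hmem (φ : ((imLanguage L M)[[A]]).Formula ι) :
      Formula.equivSentence φ ∈ p ↔ φ.Realize t := by
    rw [← ht, Theory.CompleteType.formula_mem_typeOf]
  refine ⟨?_, ?_, ?_, ?_, ?_⟩
  · rintro _ ⟨φ, -, rfl⟩
    exact ⟨φ, rfl⟩
  · rintro _ ⟨φ, hφ, rfl⟩ _ ⟨ψ, hψ, rfl⟩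
    refine ⟨φ ⊓ ψ, (hmem _).2 (Formula.realize_inf.2 ⟨(hmem _).1 hφ, (hmem _).1 hψ⟩), ?_⟩
    ext z
    exact Formula.realize_inf.symm
  · rintro _ ⟨φ, rfl⟩
    by_cases h : φ.Realize t
    · exact Or.inl ⟨φ, (hmem _).2 h, rfl⟩
    · exact Or.inr ⟨φ.not, (hmem _).2 h, rfl⟩
  · intro i
    obtain ⟨s, hs⟩ := hp i
    refine ⟨s, _, hs, ?_⟩
    ext z
    let r : ((imLanguage L M)[[A]]).Relations 1 := Sum.inl (ImRel.sort s)
    exact (Formula.realize_rel (R := r) (ts := ![Term.var i]) (v := z)).symm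
  · rintro _ ⟨φ, hφ, rfl⟩
    -- The existential closure is a sentence of the complete theory, so satisfiability of `φ`
    -- transfers from `N` to `M^eq`; variables not free in `φ` get arbitrary values.
    have h₁ : N ⊨ φ.exClosure := by
      rw [Formula.realize_exClosure]
      exact ⟨fun i => t i, (BoundedFormula.realize_restrictFreeVar (φ := φ) (f := id)
        (v := fun i : φ.freeVarFinset => t i) t (by simp)).2 ((hmem φ).1 hφ)⟩
    rw [realize_iff_of_model_completeTheory (ImElt L M) N, Formula.realize_exClosure] at h₁
    obtain ⟨z, hz⟩ := h₁
    refine ⟨fun i => if hi : i ∈ φ.freeVarFinset then z ⟨i, hi⟩ else Classical.arbitrary _, ?_⟩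
    exact (BoundedFormula.realize_restrictFreeVar (φ := φ) (f := id) _ (by simp)).1 hz

end CompleteFamily

end Imaginaries

theorem mainTheorem11 {L : FirstOrder.Language.{u, v}} {M : Type w} [L.Structure M]
    [Nonempty M] (κ : Cardinal.{y}) (hκ : ℵ₀ < κ) (hM : Imaginaries.IsSaturated L M κ)
    (A : Set (Imaginaries.ImElt L M)) (hA : Imaginaries.IsSmall κ A)
    (hacl : Imaginaries.acleq A = A)
    {ι : Type x} (hι : Imaginaries.IsSmall κ ι)
    (p : Imaginaries.TypeOver A ι) (hp : Imaginaries.IsSorted p)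
    (E : Setoid (Imaginaries.realizations p)) (hE : Imaginaries.IsTypeDefinable E)
    (hbdd : Imaginaries.IsSmall κ (Quotient E)) :
    #(Quotient E) = 1 ∨ 2 ^ ℵ₀ ≤ #(Quotient E) := by
  obtain ⟨Φ, hΦ⟩ := hE
  have h := Imaginaries.isCompleteFamily_typeFamily p hp
  have heq := Imaginaries.sInter_typeFamily p
  revert E
  rw [← heq]
  intro E hbdd hΦ
  -- Each formula of `Φ` defines an entourage, so a pair lying in all entourages satisfies `Φ`.
  exact h.mk_quotient_eq_one_or_le hκ hM hA hacl hι (fun a b hab => (hΦ a b).2 fun φ hφ =>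
    hab _ ⟨⟨φ, rfl⟩, fun a b h => (hΦ a b).1 h φ hφ⟩) hbdd
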